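/- **Setting.** Let $\mathcal H$ be a separable complex Hilbert space, $\mathcal H_2=\mathcal H\otimes\mathcal H$ its Hilbert space tensor square, and let $h$ be a (possibly unbounded) self-adjoint operator on $\mathcal H$ that is bounded below and has compact resolvent. Write $h=\sum_{e\in\mathrm{Spec}(h)}eP_e$ for its spectral resolution, $P_e$ being the orthogonal projection onto $\ker(h-e)$. Let $H_2$ be the closure of $h\otimes 1+1\otimes h$, and let $\mathcal A_2=\{\sum_{E\in\mathrm{Spec}(H_2)}f(E)P_E : f\colon\mathrm{Spec}(H_2)\to\mathbb C \text{ bounded}\}$ (strong convergence), where now $P_E$ is the orthogonal projection onto $\ker(H_2-E)$. A *collision specification* $(\mathcal C,U,\nu)$ consists of a compact metric space $\mathcal C$, an injective (strongly) continuous map $U$ from $\mathcal C$ to the unitary operators on $\mathcal H_2$, and a Borel probability measure $\nu$ on $\mathcal C$ charging every nonempty open set, such that (i) each $U(\sigma)$ commutes with $H_2$; (ii) $U(\sigma_0)=1$ for some $\sigma_0$; (iii) $\{U(\sigma)\}=\{U(\sigma)^*\}$, and the map $\sigma\mapsto\sigma'$ with $U(\sigma)^*=U(\sigma')$ is measurable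 and preserves $\nu$; (iv) with the swap $V(\phi\otimes\psi)=\psi\otimes\phi$, $\{U(\sigma)\}=\{VU(\sigma)V^*\}$, and the map $\sigma\mapsto\sigma'$ with $VU(\sigma)V^*=U(\sigma')$ is measurable and preserves $\nu$. It is *ergodic* if the commutant $\{U(\sigma):\sigma\in\mathcal C\}'$ in the bounded operators on $\mathcal H_2$ equals $\mathcal A_2$. Density matrices are the positive trace class operators of trace one. For trace class $A,B$ on $\mathcal H$ let $$A\star B=\mathrm{Tr}_2\Big[\int_{\mathcal C}U(\sigma)(A\otimes B)U(\sigma)^*\,d\nu(\sigma)\Big],$$ with $\mathrm{Tr}_2$ the partial trace over the second factor. The steady states of the quantum Kac–Boltzmann equation $\rho'=2(\rho\star\rho-\rho)$ are the density matrices $\rho$ with $\rho=\rho\star\rho$. The von Neumann entropy is $S(\rho)=-\mathrm{Tr}[\rho\log\rho]\in[0,\infty]$. **Theorem.** Let $(\mathcal C,U,\nu)$ be an ergodic collision specification. 1. If $\rho$ is a density matrix with $\rho=\rho\star\rho$ and $S(\rho)<\infty$, then $$\rho=\sum_{e\in\mathrm{Spec}(h)}\lambda_eP_e \tag{1}$$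 (convergence in operator norm) for non-negative numbers $\lambda_e$ with $\sum_{e\in\mathrm{Spec}(h)}\mathrm{Tr}[P_e]\,\lambda_e=1$, and for all $e_i,e_j,e_k,e_\ell\in\mathrm{Spec}(h)$ $$e_i+e_j=e_k+e_\ell\ \Longrightarrow\ \log\lambda_{e_i}+\log\lambda_{e_j}=\log\lambda_{e_k}+\log\lambda_{e_\ell}, \tag{2}$$ where $\log 0=-\infty$ and $-\infty+a=-\infty$ for all $a\in[-\infty,\infty)$. 2. Conversely, every density matrix $\rho$ of the form (1) with non-negative numbers $\lambda_e$ satisfying (2) is a steady state, that is, $\rho=\rho\star\rho$. -/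

import Mathlib

noncomputable section

namespace QKac

open scoped TensorProduct InnerProductSpace ENNReal NNReal BoundedContinuousFunction
open MeasureTheory UniformSpace

universe u v

/-! ### Unbounded operators -/

section Unbounded

variable {K : Type u} [NormedAddCommGroup K] [InnerProductSpace ℂ K]

/-- `R` is the resolvent `(T - z)⁻¹`: a bounded operator which maps into the domain of `T` and is
a two-sided inverse of `T - z`. -/
def IsResolventAt (T : K →ₗ.[ℂ] K) (z : ℂ) (R : K →L[ℂ] K) : Prop :=
  (∀ y : K, ∃ hy : R y ∈ T.domain, T ⟨R y, hy⟩ - z • R y = y) ∧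
    ∀ x : T.domain, R (T x - z • (x : K)) = (x : K)

/-- The (real) spectrum of an operator: the set of real `e` such that `T - e` has no bounded
inverse. All operators considered here are self-adjoint, so that this is the whole spectrum. -/
def Spec (T : K →ₗ.[ℂ] K) : Set ℝ :=
  {e : ℝ | ¬ ∃ R : K →L[ℂ] K, IsResolventAt T (e : ℂ) R}

/-- `T` has a compact resolvent. -/
def HasCompactResolvent (T : K →ₗ.[ℂ] K) : Prop :=
  ∃ (z : ℂ) (R : K →L[ℂ] K), IsResolventAt T z R ∧ IsCompactOperator R

/-- `T` is bounded below: `⟨x, T x⟩ ≥ c ‖x‖²` on the domain of `T`, for some real `c`. -/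
def IsBoundedBelow (T : K →ₗ.[ℂ] K) : Prop :=
  ∃ c : ℝ, ∀ x : T.domain, c * ‖(x : K)‖ ^ 2 ≤ (⟪(x : K), T x⟫_ℂ).re

/-- The bounded operator `B` commutes with the unbounded operator `T`, that is `B T ⊆ T B`. -/
def CommutesWith (B : K →L[ℂ] K) (T : K →ₗ.[ℂ] K) : Prop :=
  ∀ x : T.domain, ∃ hx : B (x : K) ∈ T.domain, T ⟨B (x : K), hx⟩ = B (T x)

/-- The eigenspace `ker (T - e)`. -/
def eigenspace (T : K →ₗ.[ℂ] K) (e : ℝ) : Submodule ℂ K where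
  carrier := {x | ∃ hx : x ∈ T.domain, T ⟨x, hx⟩ = (e : ℂ) • x}
  zero_mem' := ⟨T.domain.zero_mem, by
    have h0 : (⟨0, T.domain.zero_mem⟩ : T.domain) = 0 := rfl
    rw [h0, T.map_zero, smul_zero]⟩
  add_mem' := by
    rintro a b ⟨ha, ha'⟩ ⟨hb, hb'⟩
    refine ⟨T.domain.add_mem ha hb, ?_⟩
    have h0 : (⟨a + b, T.domain.add_mem ha hb⟩ : T.domain) = ⟨a, ha⟩ + ⟨b, hb⟩ := rfl
    rw [h0, T.map_add, ha', hb', smul_add]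
  smul_mem' := by
    rintro c a ⟨ha, ha'⟩
    refine ⟨T.domain.smul_mem c ha, ?_⟩
    have h0 : (⟨c • a, T.domain.smul_mem c ha⟩ : T.domain) = c • ⟨a, ha⟩ := rfl
    rw [h0, T.map_smul, ha', smul_comm]

/-- The spectral projection of `T` at `e`: the orthogonal projection onto `ker (T - e)`.
(The eigenspaces of a closed operator are closed, so that the closure changes nothing.) -/
def specProj [CompleteSpace K] (T : K →ₗ.[ℂ] K) (e : ℝ) : K →L[ℂ] K :=
  (eigenspace T e).topologicalClosure.starProjection

/-- The algebra of the bounded functions of an operator `T` with discrete spectrum: the operators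
`f(T) = ∑_E f(E) P_E`, with strong convergence, where `f` is a bounded continuous function on the
spectrum. -/
def energyAlgebra [CompleteSpace K] (T : K →ₗ.[ℂ] K) : Set (K →L[ℂ] K) :=
  {A | ∃ f : Spec T →ᵇ ℂ, ∀ x : K, HasSum (fun E : Spec T => f E • specProj T E x) (A x)}

end Unbounded

/-! ### Trace, density matrices, entropy -/

section Trace

variable {K : Type u} [NormedAddCommGroup K] [InnerProductSpace ℂ K] [CompleteSpace K]

variable (K) in
/-- The index set of a fixed Hilbert basis of `K`. -/
def basisSet : Set K := (exists_hilbertBasis ℂ K).choose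

variable (K) in
/-- A fixed Hilbert basis of `K`. -/
def hbasis : HilbertBasis (basisSet K) ℂ K := (exists_hilbertBasis ℂ K).choose_spec.choose

/-- The trace, in `[0, ∞]`, of a positive operator. It does not depend on the basis. -/
def posTrace (A : K →L[ℂ] K) : ℝ≥0∞ :=
  ∑' i : basisSet K, ENNReal.ofReal (⟪hbasis K i, A (hbasis K i)⟫_ℂ).re

/-- Density matrices: positive (hence trace class) operators of trace one. -/
def IsDensityMatrix (ρ : K →L[ℂ] K) : Prop :=
  ρ.IsPositive ∧ posTrace ρ = 1

/-- The von Neumann entropy `S(ρ) = - Tr[ρ log ρ]` of a density matrix, with values in `[0, ∞]`.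
For a density matrix the spectrum of `ρ` lies in `[0, 1]`, where `t ↦ - t log t` is nonnegative
(with `0 log 0 = 0`), and `- ρ log ρ` is the positive operator given by the functional calculus. -/
def entropy (ρ : K →L[ℂ] K) : ℝ≥0∞ :=
  posTrace (cfc Real.negMulLog ρ)

end Trace

/-! ### The two-particle space -/

section TwoParticle

variable {H : Type u} [NormedAddCommGroup H] [InnerProductSpace ℂ H]

variable (H) in
/-- The Hilbert space tensor product of `H` with itself. -/
abbrev TwoParticle : Type u := Completion (H ⊗[ℂ] H)

/-- The product vector `φ ⊗ ψ`. -/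
def tprod (φ ψ : H) : TwoParticle H := ((φ ⊗ₜ[ℂ] ψ : H ⊗[ℂ] H) : Completion (H ⊗[ℂ] H))

lemma exists_orthonormal_sum (x : H ⊗[ℂ] H) :
    ∃ (n : ℕ) (a f : Fin n → H), Orthonormal ℂ f ∧ x = ∑ j, a j ⊗ₜ[ℂ] f j := by
  obtain ⟨E', F', iE', iF', hz⟩ :=
    TensorProduct.exists_finite_submodule_of_setFinite {x} (Set.finite_singleton x)
  obtain ⟨y, hy⟩ := Set.singleton_subset_iff.mp hz
  let f := stdOrthonormalBasis ℂ F'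
  have hf : Orthonormal ℂ (fun j => ((f j : F') : H)) :=
    f.orthonormal.comp_linearIsometry F'.subtypeₗᵢ
  suffices h : ∃ a : Fin (Module.finrank ℂ F') → H, x = ∑ j, a j ⊗ₜ[ℂ] ((f j : F') : H) by
    obtain ⟨a, ha⟩ := h
    exact ⟨_, a, _, hf, ha⟩
  rw [← hy]
  clear hy hz
  induction y using TensorProduct.induction_on with
  | zero => exact ⟨0, by simp⟩
  | tmul p q =>
    refine ⟨fun j => (f.repr q j) • (p : H), ?_⟩
    have hq : (q : H) = ∑ j, f.repr q j • ((f j : F') : H) := by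
      conv_lhs => rw [← f.sum_repr q]
      push_cast
      rfl
    simp only [TensorProduct.mapIncl, TensorProduct.map_tmul, Submodule.coe_subtype]
    rw [hq, TensorProduct.tmul_sum]
    refine Finset.sum_congr rfl fun j _ => ?_
    rw [TensorProduct.smul_tmul]
  | add y z hy hz =>
    obtain ⟨a, ha⟩ := hy
    obtain ⟨b, hb⟩ := hz
    refine ⟨a + b, ?_⟩
    rw [map_add, ha, hb, ← Finset.sum_add_distrib]
    simp [TensorProduct.add_tmul]

lemma norm_sq_orthonormal_sum {n : ℕ} (a f : Fin n → H) (hf : Orthonormal ℂ f) :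
    ‖∑ j, a j ⊗ₜ[ℂ] f j‖ ^ 2 = ∑ j, ‖a j‖ ^ 2 := by
  have h := orthonormal_iff_ite.mp hf
  have h1 : ⟪∑ j, a j ⊗ₜ[ℂ] f j, ∑ j, a j ⊗ₜ[ℂ] f j⟫_ℂ = ∑ j, ⟪a j, a j⟫_ℂ := by
    simp [sum_inner, inner_sum, h]
  rw [← inner_self_eq_norm_sq (𝕜 := ℂ) (∑ j, a j ⊗ₜ[ℂ] f j)]
  refine (congrArg Complex.re h1).trans ?_
  rw [Complex.re_sum]
  exact Finset.sum_congr rfl fun j _ => inner_self_eq_norm_sq (𝕜 := ℂ) (a j)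

lemma norm_map_id_le (A : H →L[ℂ] H) (x : H ⊗[ℂ] H) :
    ‖TensorProduct.map (A : H →ₗ[ℂ] H) LinearMap.id x‖ ≤ ‖A‖ * ‖x‖ := by
  obtain ⟨n, a, f, hf, rfl⟩ := exists_orthonormal_sum x
  refine le_of_sq_le_sq ?_ (by positivity)
  simp only [map_sum, TensorProduct.map_tmul, LinearMap.id_coe, id_eq, mul_pow,
    ContinuousLinearMap.coe_coe]
  rw [norm_sq_orthonormal_sum _ f hf, norm_sq_orthonormal_sum _ f hf, Finset.mul_sum]
  refine Finset.sum_le_sum fun j _ => ?_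
  rw [← mul_pow]
  gcongr
  exact A.le_opNorm _

lemma norm_id_map_le (B : H →L[ℂ] H) (x : H ⊗[ℂ] H) :
    ‖TensorProduct.map LinearMap.id (B : H →ₗ[ℂ] H) x‖ ≤ ‖B‖ * ‖x‖ := by
  rw [← TensorProduct.norm_comm x, ← TensorProduct.norm_comm (TensorProduct.map _ _ x),
    ← TensorProduct.map_comm]
  exact norm_map_id_le B _

lemma norm_map_le (A B : H →L[ℂ] H) (x : H ⊗[ℂ] H) :
    ‖TensorProduct.map (A : H →ₗ[ℂ] H) (B : H →ₗ[ℂ] H) x‖ ≤ (‖A‖ * ‖B‖) * ‖x‖ := by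
  have h : TensorProduct.map (A : H →ₗ[ℂ] H) (B : H →ₗ[ℂ] H) x =
      TensorProduct.map (A : H →ₗ[ℂ] H) LinearMap.id
        (TensorProduct.map LinearMap.id (B : H →ₗ[ℂ] H) x) := by
    rw [← LinearMap.comp_apply, ← TensorProduct.map_comp, LinearMap.comp_id, LinearMap.id_comp]
  rw [h, mul_assoc]
  exact (norm_map_id_le A _).trans (by gcongr; exact norm_id_map_le B x)

/-- The tensor product `A ⊗ B` of two bounded operators: the continuous extension of
`φ ⊗ ψ ↦ A φ ⊗ B ψ`. -/
def opTensor (A B : H →L[ℂ] H) : TwoParticle H →L[ℂ] TwoParticle H :=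
  ((TensorProduct.map (A : H →ₗ[ℂ] H) (B : H →ₗ[ℂ] H)).mkContinuous (‖A‖ * ‖B‖)
    (norm_map_le A B)).completion

lemma opTensor_tprod (A B : H →L[ℂ] H) (φ ψ : H) :
    opTensor A B (tprod φ ψ) = tprod (A φ) (B ψ) := by
  simp [opTensor, tprod]

variable (H) in
/-- The swap operator `V (φ ⊗ ψ) = ψ ⊗ φ`. -/
def swap : TwoParticle H →L[ℂ] TwoParticle H :=
  ((TensorProduct.commIsometry ℂ H H).toLinearIsometry.toContinuousLinearMap).completion

lemma swap_tprod (φ ψ : H) : swap H (tprod φ ψ) = tprod ψ φ := by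
  simp [swap, tprod]

/-- The embedding of the algebraic tensor product `D(h) ⊗ D(h)` into the two-particle space. -/
def domainEmbed (h : H →ₗ.[ℂ] H) : h.domain ⊗[ℂ] h.domain →ₗ[ℂ] TwoParticle H :=
  (Completion.toComplL (𝕜 := ℂ) (E := H ⊗[ℂ] H)).toLinearMap ∘ₗ
    TensorProduct.mapIncl h.domain h.domain

lemma domainEmbed_injective (h : H →ₗ.[ℂ] H) : Function.Injective (domainEmbed h) := by
  have h1 : Function.Injective (TensorProduct.mapIncl h.domain h.domain) := fun _ _ hab =>
    (TensorProduct.mapInclIsometry h.domain h.domain).injective hab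
  exact (Completion.coe_injective (H ⊗[ℂ] H)).comp h1

/-- The operator `h ⊗ 1 + 1 ⊗ h` with domain the algebraic tensor product `D(h) ⊗ D(h)`. -/
def algHamiltonian₂ (h : H →ₗ.[ℂ] H) : TwoParticle H →ₗ.[ℂ] TwoParticle H where
  domain := LinearMap.range (domainEmbed h)
  toFun := ((Completion.toComplL (𝕜 := ℂ) (E := H ⊗[ℂ] H)).toLinearMap ∘ₗ
      (TensorProduct.map h.toFun h.domain.subtype + TensorProduct.map h.domain.subtype h.toFun)) ∘ₗ
    (LinearEquiv.ofInjective (domainEmbed h) (domainEmbed_injective h)).symm.toLinearMap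

lemma algHamiltonian₂_tprod (h : H →ₗ.[ℂ] H) (φ ψ : h.domain) :
    ∃ hm : tprod (φ : H) (ψ : H) ∈ (algHamiltonian₂ h).domain,
      algHamiltonian₂ h ⟨tprod (φ : H) (ψ : H), hm⟩ = tprod (h φ) (ψ : H) + tprod (φ : H) (h ψ) := by
  have hm : tprod (φ : H) (ψ : H) = domainEmbed h (φ ⊗ₜ[ℂ] ψ) := rfl
  refine ⟨⟨φ ⊗ₜ[ℂ] ψ, rfl⟩, ?_⟩
  have h1 : (LinearEquiv.ofInjective (domainEmbed h) (domainEmbed_injective h)).symm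
      ⟨tprod (φ : H) (ψ : H), ⟨φ ⊗ₜ[ℂ] ψ, rfl⟩⟩ = φ ⊗ₜ[ℂ] ψ := by
    rw [LinearEquiv.symm_apply_eq]
    rfl
  change Completion.toComplL (𝕜 := ℂ) (E := H ⊗[ℂ] H) ((TensorProduct.map h.toFun h.domain.subtype +
    TensorProduct.map h.domain.subtype h.toFun) ((LinearEquiv.ofInjective (domainEmbed h)
      (domainEmbed_injective h)).symm ⟨tprod (φ : H) (ψ : H), ⟨φ ⊗ₜ[ℂ] ψ, rfl⟩⟩)) = _
  rw [h1]
  simp only [LinearMap.add_apply, map_add, TensorProduct.map_tmul]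
  rfl

/-- The two-particle Hamiltonian `H₂ = h ⊗ 1 + 1 ⊗ h`: the closure of the operator above. -/
def hamiltonian₂ (h : H →ₗ.[ℂ] H) : TwoParticle H →ₗ.[ℂ] TwoParticle H :=
  (algHamiltonian₂ h).closure

/-- The bounded operator `H → H ⊗ H`, `φ ↦ φ ⊗ ψ`. -/
def tensorRight (ψ : H) : H →L[ℂ] TwoParticle H :=
  Completion.toComplL (𝕜 := ℂ) (E := H ⊗[ℂ] H) ∘L (TensorProduct.mkL ℂ H H).flip ψ

lemma tensorRight_apply (φ ψ : H) : tensorRight ψ φ = tprod φ ψ := rfl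

/-- The partial trace over the second factor, `Tr₂[T] = ∑ₖ Jₖ* T Jₖ` with `Jₖ φ = φ ⊗ bₖ` for a
Hilbert basis `b`; equivalently `⟨φ, Tr₂[T] ψ⟩ = ∑ₖ ⟨φ ⊗ bₖ, T (ψ ⊗ bₖ)⟩`. For a trace class
operator `T` the series converges in norm, even absolutely in trace norm, and its sum does not
depend on the basis. -/
def partialTrace₂ [CompleteSpace H] (T : TwoParticle H →L[ℂ] TwoParticle H) : H →L[ℂ] H :=
  ∑' k : basisSet H, (tensorRight (hbasis H k : H)).adjoint ∘L T ∘L tensorRight (hbasis H k : H)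

end TwoParticle

/-! ### Collisions -/

section Collisions

variable {H : Type u} [NormedAddCommGroup H] [InnerProductSpace ℂ H]

/-- A collision specification `(C, U, ν)` for the single-particle Hamiltonian `h`. Here `U` is
required to be continuous for the strong operator topology on the unitary group; every
norm-continuous `U` qualifies. -/
structure CollisionSpec (h : H →ₗ.[ℂ] H) (C : Type v) [MetricSpace C] [CompactSpace C]
    [MeasurableSpace C] [BorelSpace C] where
  /-- the collision unitaries -/
  U : C → unitary (TwoParticle H →L[ℂ] TwoParticle H)
  /-- the distribution of the collision parameter -/
  ν : Measure C
  continuous_U : ∀ x : TwoParticle H,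
    Continuous fun σ => (U σ : TwoParticle H →L[ℂ] TwoParticle H) x
  injective_U : Function.Injective U
  isProbabilityMeasure : IsProbabilityMeasure ν
  charges_open : ∀ O : Set C, IsOpen O → O.Nonempty → 0 < ν O
  commutes : ∀ σ, CommutesWith (U σ : TwoParticle H →L[ℂ] TwoParticle H) (hamiltonian₂ h)
  trivial_collision : ∃ σ₀, U σ₀ = 1
  time_reversal : ∃ τ : C → C, (∀ σ, star (U σ) = U (τ σ)) ∧ MeasurePreserving τ ν ν
  swap_symmetric : ∃ τ : C → C,
    (∀ σ, swap H ∘L (U σ : TwoParticle H →L[ℂ] TwoParticle H) ∘L (swap H).adjoint = U (τ σ)) ∧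
      MeasurePreserving τ ν ν

namespace CollisionSpec

variable {h : H →ₗ.[ℂ] H} {C : Type v} [MetricSpace C] [CompactSpace C]
    [MeasurableSpace C] [BorelSpace C]

/-- The collision unitary as a bounded operator. -/
abbrev op (S : CollisionSpec h C) (σ : C) : TwoParticle H →L[ℂ] TwoParticle H := (S.U σ).1

/-- The specification is ergodic: the commutant of the collision unitaries is the algebra of
bounded functions of the two-particle Hamiltonian. -/
def IsErgodic (S : CollisionSpec h C) : Prop :=
  {A : TwoParticle H →L[ℂ] TwoParticle H | ∀ σ, S.op σ ∘L A = A ∘L S.op σ} =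
    energyAlgebra (hamiltonian₂ h)

lemma norm_op_apply (S : CollisionSpec h C) (σ : C) (x : TwoParticle H) :
    ‖S.op σ x‖ = ‖x‖ :=
  ContinuousLinearMap.norm_map_of_mem_unitary (S.U σ).2 x

lemma norm_star_op_apply (S : CollisionSpec h C) (σ : C) (x : TwoParticle H) :
    ‖(star (S.op σ)) x‖ = ‖x‖ :=
  ContinuousLinearMap.norm_map_of_mem_unitary (Unitary.star_mem (S.U σ).2) x

lemma op_star_op_apply (S : CollisionSpec h C) (σ : C) (x : TwoParticle H) :
    S.op σ ((star (S.op σ)) x) = x := by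
  have h1 := Unitary.mul_star_self_of_mem (S.U σ).2
  exact congrArg (fun T : TwoParticle H →L[ℂ] TwoParticle H => T x) h1

lemma star_op_op_apply (S : CollisionSpec h C) (σ : C) (x : TwoParticle H) :
    (star (S.op σ)) (S.op σ x) = x := by
  have h1 := Unitary.star_mul_self_of_mem (S.U σ).2
  exact congrArg (fun T : TwoParticle H →L[ℂ] TwoParticle H => T x) h1

lemma continuous_star_op (S : CollisionSpec h C) (x : TwoParticle H) :
    Continuous fun σ => (star (S.op σ)) x := by
  rw [continuous_iff_continuousAt]
  intro σ₀
  rw [ContinuousAt, tendsto_iff_norm_sub_tendsto_zero]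
  set y := (star (S.op σ₀)) x with hy
  have h1 : ∀ σ, ‖(star (S.op σ)) x - y‖ = ‖S.op σ₀ y - S.op σ y‖ := by
    intro σ
    rw [← S.norm_op_apply σ, map_sub, S.op_star_op_apply, hy, S.op_star_op_apply]
  simp only [h1]
  have h2 : Continuous fun σ => ‖S.op σ₀ y - S.op σ y‖ :=
    (continuous_const.sub (S.continuous_U y)).norm
  simpa using h2.tendsto σ₀

lemma continuous_conj (S : CollisionSpec h C) (A : TwoParticle H →L[ℂ] TwoParticle H)
    (x : TwoParticle H) : Continuous fun σ => S.op σ (A ((star (S.op σ)) x)) := by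
  rw [continuous_iff_continuousAt]
  intro σ₀
  set y := A ((star (S.op σ₀)) x) with hy
  rw [ContinuousAt, tendsto_iff_norm_sub_tendsto_zero]
  have hc : Continuous fun σ => ‖A ((star (S.op σ)) x) - y‖ + ‖S.op σ y - S.op σ₀ y‖ :=
    ((A.continuous.comp (S.continuous_star_op x)).sub continuous_const).norm.add
      ((S.continuous_U y).sub continuous_const).norm
  have ht := hc.tendsto σ₀
  simp only [← hy, sub_self, norm_zero, add_zero] at ht
  refine squeeze_zero (fun _ => norm_nonneg _) (fun σ => ?_) ht
  calc ‖S.op σ (A ((star (S.op σ)) x)) - S.op σ₀ y‖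
      = ‖S.op σ (A ((star (S.op σ)) x) - y) + (S.op σ y - S.op σ₀ y)‖ := by
        rw [map_sub]; congr 1; abel
    _ ≤ _ := (norm_add_le _ _).trans (by rw [S.norm_op_apply])

lemma integrable_conj (S : CollisionSpec h C) (A : TwoParticle H →L[ℂ] TwoParticle H)
    (x : TwoParticle H) : Integrable (fun σ => S.op σ (A ((star (S.op σ)) x))) S.ν := by
  have := S.isProbabilityMeasure
  exact (S.continuous_conj A x).integrable_of_hasCompactSupport
    (HasCompactSupport.of_compactSpace _)

/-- The collision operator `Q A = ∫ U(σ) A U(σ)* dν(σ)`, the integral being taken in the strong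
sense: `(Q A) x = ∫ U(σ) A U(σ)* x dν(σ)`, where the integrand is continuous in `σ`. -/
def collisionOp (S : CollisionSpec h C) (A : TwoParticle H →L[ℂ] TwoParticle H) :
    TwoParticle H →L[ℂ] TwoParticle H :=
  LinearMap.mkContinuous
    { toFun := fun x => ∫ σ, S.op σ (A ((star (S.op σ)) x)) ∂S.ν
      map_add' := fun x y => by
        simp only [map_add]
        exact integral_add (S.integrable_conj A x) (S.integrable_conj A y)
      map_smul' := fun c x => by
        simp only [map_smul, RingHom.id_apply]
        exact integral_smul c _ }
    ‖A‖ (fun x => by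
      have := S.isProbabilityMeasure
      refine (norm_integral_le_of_norm_le_const (C := ‖A‖ * ‖x‖)
        (Filter.Eventually.of_forall fun σ => ?_)).trans (by simp)
      rw [S.norm_op_apply]
      refine (A.le_opNorm _).trans ?_
      rw [S.norm_star_op_apply])

lemma collisionOp_apply (S : CollisionSpec h C) (A : TwoParticle H →L[ℂ] TwoParticle H)
    (x : TwoParticle H) :
    S.collisionOp A x = ∫ σ, S.op σ (A ((star (S.op σ)) x)) ∂S.ν := rfl

/-- The quantum Wild convolution `A ⋆ B = Tr₂[Q(A ⊗ B)]` (of trace class operators). -/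
def wild [CompleteSpace H] (S : CollisionSpec h C) (A B : H →L[ℂ] H) : H →L[ℂ] H :=
  partialTrace₂ (S.collisionOp (opTensor A B))

/-- The steady states of the quantum Kac-Boltzmann equation `ρ' = 2 (ρ ⋆ ρ - ρ)`: the density
matrices `ρ` with `ρ = ρ ⋆ ρ`. -/
def IsSteadyState [CompleteSpace H] (S : CollisionSpec h C) (ρ : H →L[ℂ] H) : Prop :=
  IsDensityMatrix ρ ∧ ρ = S.wild ρ ρ

end CollisionSpec

end Collisions

/-- The coefficients `λ` on the spectrum of `h` satisfy
`e_i + e_j = e_k + e_l → log λ(e_i) + log λ(e_j) = log λ(e_k) + log λ(e_l)`.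
The logarithm takes values in `[-∞, ∞)`, with `log 0 = -∞` and `-∞ + a = -∞`. -/
def LogAdditive {H : Type u} [NormedAddCommGroup H] [InnerProductSpace ℂ H]
    {h : H →ₗ.[ℂ] H} (lam : Spec h → ℝ≥0) : Prop :=
  ∀ e₁ e₂ e₃ e₄ : Spec h, (e₁ : ℝ) + (e₂ : ℝ) = (e₃ : ℝ) + (e₄ : ℝ) →
    ENNReal.log (lam e₁) + ENNReal.log (lam e₂) = ENNReal.log (lam e₃) + ENNReal.log (lam e₄)

end QKac

end

noncomputable section

namespace QKac

open scoped TensorProduct InnerProductSpace ENNReal NNReal BoundedContinuousFunction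
open MeasureTheory UniformSpace

universe u v

/-! ### Hilbert bases, traces and diagonal operators -/

section HilbertSpace

variable {K : Type u} [NormedAddCommGroup K] [InnerProductSpace ℂ K]

/-! Diagonalise `ρ` with eigenvalues `p i`, so that `ρ ⊗ ρ` has the entries `a (i, j) = p i * p j`
in the product basis `c`. The averages over `ν` of `|⟨c m, U(σ) c k⟩|²` form a doubly stochastic
matrix `M`, and the diagonal of `Q(ρ ⊗ ρ)` is `t = M a`. The equation `ρ = ρ ⋆ ρ` says that the
first marginal of `t` is `p`; swap invariance gives the second.

Since `log a` splits as a sum over the two factors, `-∑ t log a` depends only on the marginals of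
`t`, and equals `-∑ a log a = 2 S(ρ)`. Hence the `M`-weighted sum of the nonnegative terms `a k log
(a k / a m) - a k + a m` vanishes, finite entropy making the subtraction legitimate. So `M m k ≠ 0`
forces `a m = a k` (`mul_eq_mul_of_marginals`). Where `M m k = 0`, the matrix element of every
`U(σ)` vanishes, by continuity and full support of `ν`. Thus collisions never link different
eigenvalues of `ρ ⊗ ρ`, that is, they commute with it (`IsSteadyState.op_comp_opTensor`).

Ergodicity now gives `ρ ⊗ ρ = f(H₂)`. Evaluating on products of eigenvectors of `h` shows that `ρ`
is a scalar `λ_e` on each eigenspace and that `λ_e λ_e'` depends only on `e + e'`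
(`exists_eigenvalues_of_opTensor`); the compact resolvent supplies an eigenbasis of `h`, hence the
spectral resolution.

Conversely, (2) makes `ρ ⊗ ρ` a function of the total energy, which collisions conserve. So `Q`
fixes `ρ ⊗ ρ`, and tracing out the second factor returns `ρ`. -/

lemma tsum_enorm_inner_sq {ι : Type*} (b : HilbertBasis ι ℂ K) (x : K) :
    ∑' i, ‖⟪b i, x⟫_ℂ‖ₑ ^ 2 = ‖x‖ₑ ^ 2 := by
  have h1 : HasSum (fun i => ‖⟪b i, x⟫_ℂ‖ ^ 2) (‖x‖ ^ 2) := by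
    have h2 := (b.hasSum_inner_mul_inner x x).mapL Complex.reCLM
    convert h2 using 1
    · ext i
      have : ⟪x, b i⟫_ℂ * ⟪b i, x⟫_ℂ = ((‖⟪b i, x⟫_ℂ‖ ^ 2 : ℝ) : ℂ) := by
        rw [← inner_conj_symm, mul_comm, Complex.mul_conj, Complex.normSq_eq_norm_sq]
      rw [this, Complex.reCLM_apply, Complex.ofReal_re]
    · exact (inner_self_eq_norm_sq (𝕜 := ℂ) x).symm
  have h3 : ∀ y : ℝ, 0 ≤ y → ENNReal.ofReal (y ^ 2) = ENNReal.ofReal y ^ 2 := fun y hy =>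
    ENNReal.ofReal_pow hy 2
  simp only [← ofReal_norm, ← h3 _ (norm_nonneg _)]
  rw [← ENNReal.ofReal_tsum_of_nonneg (fun i => by positivity) h1.summable, h1.tsum_eq]

lemma ofReal_re_inner_self (x : K) : ENNReal.ofReal (⟪x, x⟫_ℂ).re = ‖x‖ₑ ^ 2 := by
  have : (⟪x, x⟫_ℂ).re = ‖x‖ ^ 2 := inner_self_eq_norm_sq (𝕜 := ℂ) x
  rw [this, ENNReal.ofReal_pow (norm_nonneg _), ofReal_norm]

lemma enorm_inner_comm (x y : K) : ‖⟪x, y⟫_ℂ‖ₑ = ‖⟪y, x⟫_ℂ‖ₑ := by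
  rw [← ofReal_norm, ← ofReal_norm, norm_inner_symm]

/-- Distinct basis vectors lie at distance `√2`, so the balls of radius `1/2` around them are
disjoint. Countability is what later allows sums over the basis to be exchanged with integrals over
`ν`. -/
lemma hilbertBasis_countable [TopologicalSpace.SeparableSpace K] {ι : Type*}
    (b : HilbertBasis ι ℂ K) : Countable ι := by
  refine Pairwise.countable_of_isOpen_disjoint (s := fun i => Metric.ball (b i) (1 / 2)) ?_
    (fun i => Metric.isOpen_ball) (fun i => ⟨b i, by simp⟩)
  intro i j hij
  refine Metric.ball_disjoint_ball ?_
  have h1 : ‖b i - b j‖ ^ 2 = 2 := by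
    rw [@norm_sub_sq ℂ, b.orthonormal.1, b.orthonormal.1, b.orthonormal.2 hij]
    norm_num
  rw [dist_eq_norm]
  nlinarith [norm_nonneg (b i - b j)]

/-- Two bounded operators which agree on a Hilbert basis are equal. -/
lemma ext_hilbertBasis {F : Type*} [NormedAddCommGroup F] [NormedSpace ℂ F] {ι : Type*}
    (b : HilbertBasis ι ℂ K) {A B : K →L[ℂ] F}
    (h : ∀ i, A (b i) = B (b i)) : A = B := by
  ext x
  have h1 := (b.hasSum_repr x).mapL A
  have h2 := (b.hasSum_repr x).mapL B
  simp only [map_smul, h] at h1 h2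
  exact h1.unique h2

lemma ext_inner_hilbertBasis {ι : Type*} (b : HilbertBasis ι ℂ K) {x y : K}
    (h : ∀ i, ⟪b i, x⟫_ℂ = ⟪b i, y⟫_ℂ) : x = y := by
  apply b.repr.injective
  ext i
  simp [b.repr_apply_apply, h]

lemma re_inner_nonneg {A : K →L[ℂ] K} (hA : A.IsPositive) (x : K) : 0 ≤ (⟪x, A x⟫_ℂ).re :=
  hA.re_inner_nonneg_right x

lemma inner_eq_re {A : K →L[ℂ] K} (hA : A.IsPositive) (x : K) :
    ⟪x, A x⟫_ℂ = ((⟪x, A x⟫_ℂ).re : ℂ) :=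
  Complex.eq_re_of_ofReal_le (r := 0) (by simpa using hA.inner_nonneg_right x)

variable [CompleteSpace K]

lemma exists_sq_root {A : K →L[ℂ] K} (hA : A.IsPositive) :
    ∃ B : K →L[ℂ] K, (∀ x y, ⟪B x, y⟫_ℂ = ⟪x, B y⟫_ℂ) ∧ ∀ x, A x = B (B x) := by
  have h0 : 0 ≤ A := (ContinuousLinearMap.nonneg_iff_isPositive A).mpr hA
  refine ⟨CFC.sqrt A, ?_, fun x => ?_⟩
  · have h1 := (ContinuousLinearMap.nonneg_iff_isPositive _).mp (CFC.sqrt_nonneg A)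
    exact fun x y => h1.inner_left_eq_inner_right x y
  · exact (congrArg (fun T : K →L[ℂ] K => T x) (CFC.sqrt_mul_sqrt_self A h0)).symm

/-- The trace of a positive operator does not depend on the Hilbert basis. -/
lemma tsum_ofReal_inner_eq {ι κ : Type*} (b : HilbertBasis ι ℂ K) (c : HilbertBasis κ ℂ K)
    {A : K →L[ℂ] K} (hA : A.IsPositive) :
    ∑' i, ENNReal.ofReal (⟪b i, A (b i)⟫_ℂ).re = ∑' k, ENNReal.ofReal (⟪c k, A (c k)⟫_ℂ).re := by
  obtain ⟨B, hB, hAB⟩ := exists_sq_root hA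
  have h1 : ∀ x, ENNReal.ofReal (⟪x, A x⟫_ℂ).re = ‖B x‖ₑ ^ 2 := fun x => by
    rw [hAB, ← hB, ofReal_re_inner_self]
  simp only [h1]
  calc ∑' i, ‖B (b i)‖ₑ ^ 2 = ∑' i, ∑' k, ‖⟪c k, B (b i)⟫_ℂ‖ₑ ^ 2 := by
        simp only [tsum_enorm_inner_sq]
    _ = ∑' k, ∑' i, ‖⟪b i, B (c k)⟫_ℂ‖ₑ ^ 2 := by
        rw [ENNReal.tsum_comm]
        refine tsum_congr fun k => tsum_congr fun i => ?_
        rw [← hB, enorm_inner_comm]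
    _ = _ := by simp only [tsum_enorm_inner_sq]

lemma posTrace_eq {ι : Type*} (b : HilbertBasis ι ℂ K) {A : K →L[ℂ] K} (hA : A.IsPositive) :
    posTrace A = ∑' i, ENNReal.ofReal (⟪b i, A (b i)⟫_ℂ).re :=
  tsum_ofReal_inner_eq _ _ hA

/-- With `A = B²` and `B` symmetric, `A` is the sum of the rank-one operators `|B b k⟩⟨B b k|`.
Their norms `‖B b k‖²` add up to the trace, so the series converges in norm and `A` is a norm limit
of finite rank operators. -/
lemma isCompactOperator_of_posTrace {A : K →L[ℂ] K} (hA : A.IsPositive) (ht : posTrace A ≠ ⊤) :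
    IsCompactOperator A := by
  obtain ⟨B, hB, hAB⟩ := exists_sq_root hA
  set b := hbasis K
  have h1 : ∀ x, ENNReal.ofReal (⟪x, A x⟫_ℂ).re = ‖B x‖ₑ ^ 2 := fun x => by
    rw [hAB, ← hB, ofReal_re_inner_self]
  let R : basisSet K → K →L[ℂ] K := fun k => InnerProductSpace.rankOne ℂ (B (b k)) (B (b k))
  have hsum : Summable R := by
    refine Summable.of_norm ?_
    have h2 : ∑' k, ENNReal.ofReal (‖R k‖) ≠ ⊤ := by
      convert ht using 1
      unfold posTrace
      refine tsum_congr fun k => ?_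
      rw [h1, InnerProductSpace.norm_rankOne, ← sq, ENNReal.ofReal_pow (norm_nonneg _),
        ofReal_norm]
    have h3 := ENNReal.summable_toReal h2
    simpa using h3
  have hR : ∑' k, R k = A := by
    ext x
    have h4 : HasSum (fun k => R k x) ((∑' k, R k) x) :=
      hsum.hasSum.mapL (ContinuousLinearMap.apply ℂ K x)
    have h5 : HasSum (fun k => R k x) (A x) := by
      have h6 := (b.hasSum_repr (B x)).mapL B
      rw [hAB]
      convert h6 using 1
      ext k
      simp [R, b.repr_apply_apply, hB]
    exact h4.unique h5
  rw [← hR]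
  refine isCompactOperator_of_tendsto (F := fun s : Finset (basisSet K) => ∑ k ∈ s, R k)
    hsum.hasSum (Filter.Eventually.of_forall fun s => ?_)
  induction s using Finset.cons_induction with
  | empty => simpa using isCompactOperator_zero
  | cons k s hk ih =>
    rw [Finset.sum_cons]
    refine IsCompactOperator.add ?_ ih
    exact (isCompactOperator_of_locallyCompactSpace_rng
      (ContinuousLinearMap.toSpanSingleton ℂ (B (b k)))).comp_clm (innerSL ℂ (B (b k)))

/-- A compact self-adjoint operator has a Hilbert basis of eigenvectors. -/
lemma exists_eigenbasis {A : K →L[ℂ] K} (hA : IsCompactOperator A)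
    (hs : (A : K →ₗ[ℂ] K).IsSymmetric) :
    ∃ (ι : Type u) (b : HilbertBasis ι ℂ K) (p : ι → ℝ), ∀ i, A (b i) = (p i : ℂ) • b i := by
  -- All complex `μ` are admitted: the value `0` contributes the kernel, and a non-eigenvalue has an
  -- empty basis. Gluing the bases of the eigenspaces gives a basis of `K`; symmetry makes each
  -- occurring `μ` real.
  let E : ℂ → Submodule ℂ K := fun μ => Module.End.eigenspace (A : K →ₗ[ℂ] K) μ
  have hEmem : ∀ μ x, x ∈ E μ ↔ A x = μ • x := fun μ x => Module.End.mem_eigenspace_iff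
  have hclosed : ∀ μ, IsClosed (E μ : Set K) := fun μ => by
    have : (E μ : Set K) = {x | A x = μ • x} := by ext x; exact hEmem μ x
    rw [this]
    exact isClosed_eq A.continuous (continuous_const_smul μ)
  have : ∀ μ, CompleteSpace (E μ) := fun μ => (hclosed μ).completeSpace_coe
  have hort : OrthogonalFamily ℂ (fun μ => E μ) fun μ => (E μ).subtypeₗᵢ :=
    hs.orthogonalFamily_eigenspaces
  have hv := hort.orthonormal_sigma_orthonormal (v_family := fun μ => hbasis (E μ))
    (fun μ => (hbasis (E μ)).orthonormal)
  have hbot : (⨆ μ, E μ)ᗮ = ⊥ :=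
    ContinuousLinearMap.orthogonalComplement_iSup_eigenspaces_eq_bot hA hs
  have hsp : (Submodule.span ℂ (Set.range
      fun a : Σ μ, basisSet (E μ) => (E a.1).subtypeₗᵢ (hbasis (E a.1) a.2)))ᗮ = ⊥ := by
    rw [eq_bot_iff, ← hbot]
    intro x hx
    rw [Submodule.mem_orthogonal'] at hx ⊢
    have h1 : ∀ μ, E μ ≤ LinearMap.ker (innerSL ℂ x).toLinearMap := by
      intro μ y hy
      rw [LinearMap.mem_ker]
      have h2 := ((hbasis (E μ)).hasSum_repr ⟨y, hy⟩).mapL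
        ((innerSL ℂ x) ∘L (E μ).subtypeL)
      have h3 : ∀ i, ((innerSL ℂ x) ∘L (E μ).subtypeL)
          ((hbasis (E μ)).repr ⟨y, hy⟩ i • hbasis (E μ) i) = 0 := fun i => by
        rw [map_smul]
        have := hx _ (Submodule.subset_span ⟨⟨μ, i⟩, rfl⟩)
        simp only [Submodule.coe_subtypeₗᵢ, Submodule.subtype_apply] at this
        exact (congrArg _ this).trans (smul_zero _)
      simp only [h3] at h2
      exact h2.unique hasSum_zero
    intro y hy
    exact LinearMap.mem_ker.mp ((iSup_le h1 : ⨆ μ, E μ ≤ _) hy)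
  let b := HilbertBasis.mkOfOrthogonalEqBot hv hsp
  have hb : ∀ a, b a = ((hbasis (E a.1) a.2 : E a.1) : K) := fun a => by
    simp [b]
  refine ⟨_, b, fun a => a.1.re, fun a => ?_⟩
  have h1 : A (b a) = a.1 • b a := by
    rw [hb]
    exact (hEmem _ _).mp (hbasis (E a.1) a.2).2
  have h2 : (starRingEnd ℂ) a.1 = a.1 := by
    have h3 := hs (b a) (b a)
    simp only [ContinuousLinearMap.coe_coe, h1, inner_smul_left, inner_smul_right] at h3
    have h4 : b a ≠ 0 := b.orthonormal.ne_zero a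
    simpa [h4] using h3
  rw [h1]
  congr 1
  exact (Complex.conj_eq_iff_re.mp h2).symm

/-- The claim is closed under sums, products and norm limits and holds for constants and the
identity, so Stone–Weierstrass gives it for every continuous function on the spectrum. -/
lemma cfc_apply_eigenvector {A : K →L[ℂ] K} (hA : IsSelfAdjoint A) {x : K} {μ : ℝ}
    (hx : A x = (μ : ℂ) • x) (f : ℝ → ℝ) (hf : Continuous f) :
    cfc f A x = ((f μ : ℝ) : ℂ) • x := by
  rcases eq_or_ne x 0 with rfl | hx0
  · simp
  have hμ : μ ∈ spectrum ℝ A := by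
    rw [spectrum.mem_iff]
    intro hu
    have h1 : (algebraMap ℝ (K →L[ℂ] K) μ - A) x = 0 := by
      rw [sub_apply, hx, Algebra.algebraMap_eq_smul_one]
      simp
    obtain ⟨V, hV⟩ := hu.exists_left_inv
    have h2 : (V * (algebraMap ℝ (K →L[ℂ] K) μ - A)) x = 0 := by
      rw [mul_apply_eq_comp, h1, map_zero]
    rw [hV] at h2
    exact hx0 h2
  rw [cfc_apply f A hA hf.continuousOn]
  suffices h : ∀ g : C(spectrum ℝ A, ℝ), cfcHom hA g x = ((g ⟨μ, hμ⟩ : ℝ) : ℂ) • x from h _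
  intro g
  induction g using ContinuousMap.induction_on_of_compact with
  | const r =>
    have : (ContinuousMap.const (spectrum ℝ A) r) = algebraMap ℝ C(spectrum ℝ A, ℝ) r := rfl
    rw [this, AlgHomClass.commutes, Algebra.algebraMap_eq_smul_one]
    simp
  | id => rw [cfcHom_id hA, hx]; rfl
  | star_id => rw [star_trivial, cfcHom_id hA, hx]; rfl
  | add f g hf hg =>
    rw [map_add, add_apply, hf, hg, ← add_smul]
    simp
  | mul f g hf hg =>
    rw [map_mul, mul_apply_eq_comp, hg, map_smul, hf, smul_smul]
    simp [mul_comm]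
  | frequently f hf =>
    have hc : IsClosed {g : C(spectrum ℝ A, ℝ) | cfcHom hA g x = ((g ⟨μ, hμ⟩ : ℝ) : ℂ) • x} := by
      refine isClosed_eq ?_ ?_
      · exact (ContinuousLinearMap.apply ℂ K x).continuous.comp (cfcHom_continuous hA)
      · exact (Complex.continuous_ofReal.comp (continuous_eval_const _)).smul
          continuous_const
    exact hc.mem_of_frequently_of_tendsto hf Filter.tendsto_id

/-- An operator which is diagonal in a Hilbert basis with real entries is self-adjoint. -/
lemma isSelfAdjoint_of_diagonal {ι : Type*} (b : HilbertBasis ι ℂ K) {A : K →L[ℂ] K} {p : ι → ℝ}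
    (h : ∀ i, A (b i) = (p i : ℂ) • b i) : IsSelfAdjoint A := by
  classical
  rw [ContinuousLinearMap.isSelfAdjoint_iff']
  refine ext_hilbertBasis b fun i => ext_inner_hilbertBasis b fun j => ?_
  rw [ContinuousLinearMap.adjoint_inner_right, h, h, inner_smul_left, inner_smul_right,
    orthonormal_iff_ite.mp b.orthonormal, Complex.conj_ofReal]
  split_ifs with hij
  · rw [hij]
  · simp

lemma inner_of_diagonal {ι : Type*} (b : HilbertBasis ι ℂ K) {A : K →L[ℂ] K}
    {p : ι → ℝ} (h : ∀ i, A (b i) = (p i : ℂ) • b i) (i : ι) (x : K) :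
    ⟪b i, A x⟫_ℂ = p i * ⟪b i, x⟫_ℂ := by
  have h2 : ⟪A (b i), x⟫_ℂ = ⟪b i, A x⟫_ℂ := (isSelfAdjoint_of_diagonal b h).isSymmetric (b i) x
  rw [← h2, h, inner_smul_left, Complex.conj_ofReal]

/-- The quadratic form of a diagonal operator with nonnegative entries. -/
lemma ofReal_inner_of_diagonal {ι : Type*} (b : HilbertBasis ι ℂ K)
    {A : K →L[ℂ] K} {p : ι → ℝ} (hp : ∀ i, 0 ≤ p i)
    (h : ∀ i, A (b i) = (p i : ℂ) • b i) (x : K) :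
    ENNReal.ofReal (⟪x, A x⟫_ℂ).re = ∑' i, ENNReal.ofReal (p i) * ‖⟪b i, x⟫_ℂ‖ₑ ^ 2 := by
  have h1 := (b.hasSum_inner_mul_inner x (A x)).mapL Complex.reCLM
  have h2 : ∀ i, Complex.reCLM (⟪x, b i⟫_ℂ * ⟪b i, A x⟫_ℂ) = p i * ‖⟪b i, x⟫_ℂ‖ ^ 2 := fun i => by
    rw [inner_of_diagonal b h, ← inner_conj_symm x (b i), mul_left_comm,
      mul_comm (starRingEnd ℂ _), Complex.mul_conj, Complex.normSq_eq_norm_sq, ← Complex.ofReal_mul,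
      Complex.reCLM_apply, Complex.ofReal_re]
  simp only [h2] at h1
  change ENNReal.ofReal (Complex.reCLM ⟪x, A x⟫_ℂ) = _
  rw [← h1.tsum_eq, ENNReal.ofReal_tsum_of_nonneg (fun i => mul_nonneg (hp i) (sq_nonneg _))
    h1.summable]
  refine tsum_congr fun i => ?_
  rw [ENNReal.ofReal_mul (hp i), ENNReal.ofReal_pow (norm_nonneg _), ofReal_norm]

/-- An operator which is diagonal in a Hilbert basis with nonnegative entries is positive. -/
lemma isPositive_of_diagonal {ι : Type*} (b : HilbertBasis ι ℂ K) {A : K →L[ℂ] K}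
    {p : ι → ℝ} (hp : ∀ i, 0 ≤ p i) (h : ∀ i, A (b i) = (p i : ℂ) • b i) : A.IsPositive := by
  have hA := isSelfAdjoint_of_diagonal b h
  rw [ContinuousLinearMap.isPositive_def']
  refine ⟨hA, fun x => ?_⟩
  have h1 := (b.hasSum_inner_mul_inner (A x) x).mapL Complex.reCLM
  rw [ContinuousLinearMap.reApplyInnerSelf_apply]
  refine h1.nonneg fun i => ?_
  have h2 : ⟪A x, b i⟫_ℂ = ⟪x, A (b i)⟫_ℂ := hA.isSymmetric x (b i)
  rw [h2, h, inner_smul_right, mul_assoc, ← inner_conj_symm x (b i), mul_comm (starRingEnd ℂ _),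
    Complex.mul_conj]
  simp only [Complex.reCLM_apply, ← Complex.ofReal_mul, Complex.ofReal_re]
  exact mul_nonneg (hp i) (Complex.normSq_nonneg _)

lemma posTrace_of_diagonal {ι : Type*} (b : HilbertBasis ι ℂ K) {A : K →L[ℂ] K}
    (hA : A.IsPositive) {p : ι → ℝ} (h : ∀ i, A (b i) = (p i : ℂ) • b i) :
    posTrace A = ∑' i, ENNReal.ofReal (p i) := by
  rw [posTrace_eq b hA]
  refine tsum_congr fun i => ?_
  rw [h, inner_smul_right, inner_self_eq_norm_sq_to_K, b.orthonormal.1]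
  simp

end HilbertSpace

/-! ### Eigenspaces and spectral projections of symmetric operators -/

section Symmetric

variable {K : Type u} [NormedAddCommGroup K] [InnerProductSpace ℂ K]

lemma inner_eq_zero_of_mem_eigenspace {T : K →ₗ.[ℂ] K} (hT : T.IsFormalAdjoint T) {e e' : ℝ}
    (hne : e ≠ e') {x y : K} (hx : x ∈ eigenspace T e) (hy : y ∈ eigenspace T e') :
    ⟪x, y⟫_ℂ = 0 := by
  obtain ⟨hx1, hx2⟩ := hx
  obtain ⟨hy1, hy2⟩ := hy
  have h1 := hT ⟨x, hx1⟩ ⟨y, hy1⟩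
  rw [hx2, hy2, inner_smul_left, inner_smul_right, Complex.conj_ofReal] at h1
  have h2 : ((e : ℂ) - e') * ⟪x, y⟫_ℂ = 0 := by rw [sub_mul, sub_eq_zero]; exact h1
  rcases mul_eq_zero.mp h2 with h3 | h3
  · exact absurd (by exact_mod_cast sub_eq_zero.mp h3) hne
  · exact h3

lemma mem_spec_of_mem_eigenspace {T : K →ₗ.[ℂ] K} {e : ℝ} {x : K} (hx : x ∈ eigenspace T e)
    (hx0 : x ≠ 0) : e ∈ Spec T := by
  rintro ⟨R, -, hR⟩
  obtain ⟨hx1, hx2⟩ := hx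
  have h1 := hR ⟨x, hx1⟩
  rw [hx2] at h1
  simp only [sub_self, map_zero] at h1
  exact hx0 h1.symm

variable [CompleteSpace K]

lemma specProj_apply_of_mem {T : K →ₗ.[ℂ] K} {e : ℝ} {x : K} (hx : x ∈ eigenspace T e) :
    specProj T e x = x :=
  Submodule.starProjection_eq_self_iff.mpr (Submodule.le_topologicalClosure _ hx)

lemma specProj_apply_of_ne {T : K →ₗ.[ℂ] K} (hT : T.IsFormalAdjoint T) {e e' : ℝ} (hne : e ≠ e')
    {x : K} (hx : x ∈ eigenspace T e') : specProj T e x = 0 := by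
  rw [specProj, Submodule.starProjection_apply_eq_zero_iff, Submodule.orthogonal_closure,
    Submodule.mem_orthogonal]
  exact fun y hy => inner_eq_zero_of_mem_eigenspace hT hne hy hx

lemma isPositive_specProj (T : K →ₗ.[ℂ] K) (e : ℝ) : (specProj T e).IsPositive :=
  ContinuousLinearMap.IsPositive.of_isStarProjection isStarProjection_starProjection

lemma norm_specProj_le (T : K →ₗ.[ℂ] K) (e : ℝ) : ‖specProj T e‖ ≤ 1 :=
  Submodule.starProjection_norm_le _

/-- A strongly convergent sum `∑ f(E) P_E` acts as `f(E)` on the eigenspace at `E`. -/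
lemma hasSum_specProj_apply {T : K →ₗ.[ℂ] K} (hT : T.IsFormalAdjoint T) {f : Spec T → ℂ} {x y : K}
    (E : Spec T) (hx : x ∈ eigenspace T E)
    (h : HasSum (fun E : Spec T => f E • specProj T E x) y) : y = f E • x := by
  refine h.unique ?_
  convert hasSum_single E ?_ using 1
  · rw [specProj_apply_of_mem hx]
  · intro E' hE'
    rw [specProj_apply_of_ne hT (fun hh => hE' (Subtype.ext hh)) hx, smul_zero]

end Symmetric

/-! ### The two-particle space and its Hamiltonian -/

section Tensor

variable {H : Type u} [NormedAddCommGroup H] [InnerProductSpace ℂ H]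

lemma inner_tprod (a b c d : H) : ⟪tprod a b, tprod c d⟫_ℂ = ⟪a, c⟫_ℂ * ⟪b, d⟫_ℂ := by
  simp [tprod, Completion.inner_coe, TensorProduct.inner_tmul]

/-- The bounded operator `H → H ⊗ H`, `ψ ↦ φ ⊗ ψ`. -/
def tensorLeft (φ : H) : H →L[ℂ] TwoParticle H :=
  Completion.toComplL (𝕜 := ℂ) (E := H ⊗[ℂ] H) ∘L (TensorProduct.mkL ℂ H H) φ

lemma tensorLeft_apply (φ ψ : H) : tensorLeft φ ψ = tprod φ ψ := rfl

lemma tprod_smul_left (c : ℂ) (a b : H) : tprod (c • a) b = c • tprod a b :=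
  (tensorRight b).map_smul c a

lemma tprod_smul_right (c : ℂ) (a b : H) : tprod a (c • b) = c • tprod a b :=
  (tensorLeft a).map_smul c b

lemma eq_zero_of_inner_tprod {x : TwoParticle H} (hx : ∀ φ ψ, ⟪x, tprod φ ψ⟫_ℂ = 0) : x = 0 := by
  have h1 : ∀ y : H ⊗[ℂ] H, ⟪x, (y : Completion (H ⊗[ℂ] H))⟫_ℂ = 0 := fun y => by
    induction y using TensorProduct.induction_on with
    | zero => rw [Completion.coe_zero, inner_zero_right]
    | tmul p q => exact hx p q
    | add p q hp hq => rw [Completion.coe_add, inner_add_right, hp, hq, add_zero]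
  have h2 : ⟪x, x⟫_ℂ = 0 := by
    refine Completion.induction_on (p := fun y => ⟪x, y⟫_ℂ = 0) x ?_ h1
    exact isClosed_eq (continuous_const.inner continuous_id) continuous_const
  exact inner_self_eq_zero.mp h2

/-- The Hilbert basis `b i ⊗ c j` of the two-particle space. -/
def tensorBasis {ι κ : Type*} (b : HilbertBasis ι ℂ H) (c : HilbertBasis κ ℂ H) :
    HilbertBasis (ι × κ) ℂ (TwoParticle H) :=
  HilbertBasis.mkOfOrthogonalEqBot (v := fun i : ι × κ => tprod (b i.1) (c i.2))
    (by
      classical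
      rw [orthonormal_iff_ite]
      rintro ⟨i, j⟩ ⟨k, l⟩
      rw [inner_tprod, orthonormal_iff_ite.mp b.orthonormal, orthonormal_iff_ite.mp c.orthonormal]
      simp only [Prod.mk.injEq]
      split_ifs <;> simp_all)
    (by
      rw [eq_bot_iff]
      intro x hx
      rw [Submodule.mem_orthogonal'] at hx
      have h0 : ∀ i j, ⟪x, tprod (b i) (c j)⟫_ℂ = 0 := fun i j =>
        hx _ (Submodule.subset_span ⟨(i, j), rfl⟩)
      refine eq_zero_of_inner_tprod fun φ ψ => ?_
      have h1 : ∀ i ψ, ⟪x, tprod (b i) ψ⟫_ℂ = 0 := fun i ψ => by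
        have : (innerSL ℂ x) ∘L tensorLeft (b i) = 0 :=
          ext_hilbertBasis c fun j => h0 i j
        exact congrArg (fun T : H →L[ℂ] ℂ => T ψ) this
      have : (innerSL ℂ x) ∘L tensorRight ψ = 0 := ext_hilbertBasis b fun i => h1 i ψ
      exact congrArg (fun T : H →L[ℂ] ℂ => T φ) this)

lemma tensorBasis_apply {ι κ : Type*} (b : HilbertBasis ι ℂ H) (c : HilbertBasis κ ℂ H)
    (i : ι × κ) : tensorBasis b c i = tprod (b i.1) (c i.2) := by
  simp [tensorBasis]

lemma swap_inner (x y : TwoParticle H) : ⟪swap H x, y⟫_ℂ = ⟪x, swap H y⟫_ℂ := by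
  refine Completion.induction_on₂ (p := fun x y => ⟪swap H x, y⟫_ℂ = ⟪x, swap H y⟫_ℂ) x y ?_ ?_
  · exact isClosed_eq (((swap H).continuous.comp continuous_fst).inner continuous_snd)
      (continuous_fst.inner ((swap H).continuous.comp continuous_snd))
  · intro x y
    have h1 : ∀ z : H ⊗[ℂ] H, swap H (z : Completion (H ⊗[ℂ] H)) =
        ((TensorProduct.comm ℂ H H z : H ⊗[ℂ] H) : Completion (H ⊗[ℂ] H)) := fun z => by
      simp [swap]
    rw [h1, h1, Completion.inner_coe, Completion.inner_coe]
    have h2 := (TensorProduct.commIsometry ℂ H H).inner_map_map x (TensorProduct.comm ℂ H H y)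
    simpa using h2

lemma algHamiltonian₂_isFormalAdjoint {h : H →ₗ.[ℂ] H} (hh : h.IsFormalAdjoint h) :
    (algHamiltonian₂ h).IsFormalAdjoint (algHamiltonian₂ h) := by
  have key : ∀ u v : h.domain ⊗[ℂ] h.domain,
      ⟪(TensorProduct.map h.toFun h.domain.subtype + TensorProduct.map h.domain.subtype h.toFun) u,
        TensorProduct.mapIncl h.domain h.domain v⟫_ℂ =
      ⟪TensorProduct.mapIncl h.domain h.domain u,
        (TensorProduct.map h.toFun h.domain.subtype +
          TensorProduct.map h.domain.subtype h.toFun) v⟫_ℂ := by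
    intro u v
    induction u using TensorProduct.induction_on with
    | zero => simp
    | add p q hp hq => rw [map_add, map_add, inner_add_left, inner_add_left, hp, hq]
    | tmul a b =>
      induction v using TensorProduct.induction_on with
      | zero => simp
      | add p q hp hq => rw [map_add, map_add, inner_add_right, inner_add_right, hp, hq]
      | tmul c d =>
        have h1 : ⟪h.toFun a, (c : H)⟫_ℂ = ⟪(a : H), h.toFun c⟫_ℂ := hh a c
        have h2 : ⟪h.toFun b, (d : H)⟫_ℂ = ⟪(b : H), h.toFun d⟫_ℂ := hh b d
        simp only [LinearMap.add_apply, TensorProduct.map_tmul, TensorProduct.mapIncl,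
          inner_add_left, inner_add_right, TensorProduct.inner_tmul, Submodule.subtype_apply, h1,
          h2]
  have happ : ∀ u : h.domain ⊗[ℂ] h.domain, ∀ hu : domainEmbed h u ∈ (algHamiltonian₂ h).domain,
      algHamiltonian₂ h ⟨domainEmbed h u, hu⟩ = (((TensorProduct.map h.toFun h.domain.subtype +
        TensorProduct.map h.domain.subtype h.toFun) u : H ⊗[ℂ] H) : Completion (H ⊗[ℂ] H)) := by
    intro u hu
    have h1 : (LinearEquiv.ofInjective (domainEmbed h) (domainEmbed_injective h)).symm
        ⟨domainEmbed h u, hu⟩ = u := by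
      rw [LinearEquiv.symm_apply_eq]; rfl
    change Completion.toComplL (𝕜 := ℂ) (E := H ⊗[ℂ] H) ((TensorProduct.map h.toFun
      h.domain.subtype + TensorProduct.map h.domain.subtype h.toFun)
        ((LinearEquiv.ofInjective (domainEmbed h) (domainEmbed_injective h)).symm
          ⟨domainEmbed h u, hu⟩)) = _
    rw [h1]
    rfl
  rintro ⟨_, u, rfl⟩ ⟨_, v, rfl⟩
  have h1 := congrArg (fun z => ⟪z, domainEmbed h v⟫_ℂ) (happ u ⟨u, rfl⟩)
  have h2 := congrArg (fun z => ⟪domainEmbed h u, z⟫_ℂ) (happ v ⟨v, rfl⟩)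
  exact h1.trans ((Completion.inner_coe _ _).trans
    ((key u v).trans ((Completion.inner_coe _ _).symm.trans h2.symm)))

/-- Symmetry is a closed condition on pairs of points of the graph, so it passes to the closure one
argument at a time. For a non-closable operator `closure` is by convention the operator itself, so
closability need not be proved. -/
lemma closure_isFormalAdjoint {K : Type u} [NormedAddCommGroup K] [InnerProductSpace ℂ K]
    {T : K →ₗ.[ℂ] K} (hT : T.IsFormalAdjoint T) : T.closure.IsFormalAdjoint T.closure := by
  by_cases hc : T.IsClosable
  · have hg : ∀ p ∈ T.closure.graph, p ∈ _root_.closure (T.graph : Set (K × K)) := fun p hp => by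
      rw [← hc.graph_closure_eq_closure_graph] at hp
      exact hp
    have h0 : ∀ p ∈ T.graph, ∀ q ∈ T.graph, ⟪p.2, q.1⟫_ℂ = ⟪p.1, q.2⟫_ℂ := by
      rintro ⟨p1, p2⟩ hp ⟨q1, q2⟩ hq
      obtain ⟨x, rfl, rfl⟩ := (LinearPMap.mem_graph_iff T).mp hp
      obtain ⟨y, rfl, rfl⟩ := (LinearPMap.mem_graph_iff T).mp hq
      exact hT x y
    have h1 : ∀ p ∈ T.closure.graph, ∀ q ∈ T.graph, ⟪p.2, q.1⟫_ℂ = ⟪p.1, q.2⟫_ℂ := by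
      intro p hp q hq
      refine closure_minimal (t := {p : K × K | ⟪p.2, q.1⟫_ℂ = ⟪p.1, q.2⟫_ℂ})
        (fun p hp => h0 p hp q hq) ?_ (hg p hp)
      exact isClosed_eq (continuous_snd.inner continuous_const)
        (continuous_fst.inner continuous_const)
    intro x y
    refine closure_minimal (t := {q : K × K | ⟪T.closure x, q.1⟫_ℂ = ⟪(x : K), q.2⟫_ℂ})
      (fun q hq => h1 _ (T.closure.mem_graph x) q hq) ?_ (hg _ (T.closure.mem_graph y))
    exact isClosed_eq (continuous_const.inner continuous_fst)
      (continuous_const.inner continuous_snd)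
  · rwa [LinearPMap.closure_def' hc]

lemma hamiltonian₂_isFormalAdjoint {h : H →ₗ.[ℂ] H} (hh : h.IsFormalAdjoint h) :
    (hamiltonian₂ h).IsFormalAdjoint (hamiltonian₂ h) :=
  closure_isFormalAdjoint (algHamiltonian₂_isFormalAdjoint hh)

/-- Energies add. This is the only link needed between the spectra of `h` and of `H₂`. -/
lemma tprod_mem_eigenspace {h : H →ₗ.[ℂ] H} {e e' : ℝ} {x y : H} (hx : x ∈ eigenspace h e)
    (hy : y ∈ eigenspace h e') : tprod x y ∈ eigenspace (hamiltonian₂ h) (e + e') := by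
  obtain ⟨hx1, hx2⟩ := hx
  obtain ⟨hy1, hy2⟩ := hy
  obtain ⟨hm, hval⟩ := algHamiltonian₂_tprod h ⟨x, hx1⟩ ⟨y, hy1⟩
  have hle := (algHamiltonian₂ h).le_closure
  refine ⟨hle.1 hm, ?_⟩
  have h1 := hle.2 (x := ⟨tprod x y, hm⟩) (y := ⟨tprod x y, hle.1 hm⟩) rfl
  refine h1.symm.trans (hval.trans ?_)
  rw [hx2, hy2, tprod_smul_left, tprod_smul_right, ← add_smul]
  simp

end Tensor

/-! ### Compact resolvents and eigenbases -/

section Resolvent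

variable {K : Type u} [NormedAddCommGroup K] [InnerProductSpace ℂ K] [CompleteSpace K]

/-- If `T` has a compact resolvent at some point, then it has a compact resolvent at each point
which is not an eigenvalue. -/
lemma exists_compact_resolventAt {T : K →ₗ.[ℂ] K} {z : ℂ} {R : K →L[ℂ] K}
    (hR : IsResolventAt T z R) (hc : IsCompactOperator R) (w : ℂ)
    (hw : ∀ x : T.domain, T x = w • (x : K) → (x : K) = 0) :
    ∃ R' : K →L[ℂ] K, IsResolventAt T w R' ∧ IsCompactOperator R' := by
  obtain ⟨hR1, hR2⟩ := hR
  rcases eq_or_ne w z with rfl | hne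
  · exact ⟨R, ⟨hR1, hR2⟩, hc⟩
  have hwz : w - z ≠ 0 := sub_ne_zero.mpr hne
  have hμ : (w - z)⁻¹ ≠ 0 := inv_ne_zero hwz
  -- Fredholm alternative: an eigenvector of `R` at `(w - z)⁻¹` would be an eigenvector of `T` at
  -- `w`.
  rcases hc.hasEigenvalue_or_mem_resolventSet hμ with hev | hres
  · obtain ⟨x, hx⟩ := hev.exists_hasEigenvector
    have hx1 : R x = (w - z)⁻¹ • x := hx.apply_eq_smul
    obtain ⟨hm, hval⟩ := hR1 x
    have h1 : R x = 0 := by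
      refine hw ⟨R x, hm⟩ ?_
      have h2 : (w - z) • R x = x := by rw [hx1, smul_inv_smul₀ hwz]
      have h3 : T ⟨R x, hm⟩ - z • R x = (w - z) • R x := hval.trans h2.symm
      rw [sub_smul, sub_left_inj] at h3
      exact h3
    rw [hx1] at h1
    exact absurd ((smul_eq_zero.mp h1).resolve_left hμ) hx.2
  · rw [spectrum.mem_resolventSet_iff] at hres
    obtain ⟨⟨G, V, hGV, hVG⟩, hG⟩ := hres
    simp only at hG
    subst hG
    have h1 : ∀ y, (w - z)⁻¹ • V y - R (V y) = y := fun y => by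
      have := congrArg (fun A : K →L[ℂ] K => A y) hGV
      simpa [Algebra.algebraMap_eq_smul_one] using this
    have h2 : ∀ y, V ((w - z)⁻¹ • y - R y) = y := fun y => by
      have := congrArg (fun A : K →L[ℂ] K => A y) hVG
      simpa [Algebra.algebraMap_eq_smul_one] using this
    -- From `T - w = (T - z)(1 - (w - z) R)` on the range of `R`; the inverse of the last factor is
    -- `(w - z)⁻¹ • V`.
    refine ⟨R ∘L ((w - z)⁻¹ • V), ⟨fun y => ?_, fun x => ?_⟩, hc.comp_clm _⟩
    · obtain ⟨hm, hval⟩ := hR1 ((w - z)⁻¹ • V y)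
      refine ⟨hm, ?_⟩
      have h3 : T ⟨R ((w - z)⁻¹ • V y), hm⟩ = (w - z)⁻¹ • V y + z • R ((w - z)⁻¹ • V y) :=
        sub_eq_iff_eq_add.mp hval
      change T ⟨R ((w - z)⁻¹ • V y), hm⟩ - w • R ((w - z)⁻¹ • V y) = y
      rw [h3, add_sub_assoc, ← sub_smul, ← neg_sub w z, neg_smul, map_smul R,
        smul_inv_smul₀ hwz, ← sub_eq_add_neg]
      exact h1 y
    · have h3 : R (T x - w • (x : K)) = (w - z) • ((w - z)⁻¹ • (x : K) - R x) := by
        have h4 : T x - w • (x : K) = (T x - z • (x : K)) - (w - z) • (x : K) := by module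
        rw [h4, map_sub, hR2, map_smul, smul_sub, smul_inv_smul₀ hwz]
      have h7 : ∀ u, R (V u) = V (R u) := fun u => by
        have h6 : V ((w - z)⁻¹ • u - R u) = (w - z)⁻¹ • V u - R (V u) := (h2 u).trans (h1 u).symm
        rw [map_sub, map_smul] at h6
        exact (sub_right_injective h6).symm
      change R ((w - z)⁻¹ • V (T x - w • (x : K))) = x
      rw [map_smul, h7, h3, map_smul, h2, inv_smul_smul₀ hwz]

/-- The spectrum of an operator with compact resolvent consists of eigenvalues. -/
lemma exists_mem_eigenspace_of_mem_spec {T : K →ₗ.[ℂ] K} (hT : HasCompactResolvent T) {e : ℝ}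
    (he : e ∈ Spec T) : ∃ x ∈ eigenspace T e, x ≠ 0 := by
  obtain ⟨z, R, hR, hc⟩ := hT
  by_contra! hcon
  obtain ⟨R', hR', -⟩ := exists_compact_resolventAt hR hc (e : ℂ)
    fun x hx => hcon x ⟨x.2, hx⟩
  exact he ⟨R', hR'⟩

/-- A symmetric operator which is bounded below and has compact resolvent has a Hilbert basis of
eigenvectors. -/
lemma exists_eigenbasis_of_hasCompactResolvent {T : K →ₗ.[ℂ] K} (hs : T.IsFormalAdjoint T)
    (hb : IsBoundedBelow T) (hT : HasCompactResolvent T) :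
    ∃ (ι : Type u) (b : HilbertBasis ι ℂ K) (ε : ι → Spec T), ∀ i, b i ∈ eigenspace T (ε i) := by
  obtain ⟨c, hc⟩ := hb
  obtain ⟨z, R₀, hR₀, hc₀⟩ := hT
  -- The point `c - 1` lies below the lower bound `c`, so it is no eigenvalue; being real, it makes
  -- the resolvent symmetric.
  obtain ⟨R, ⟨hR1, hR2⟩, hcR⟩ := exists_compact_resolventAt hR₀ hc₀ ((c - 1 : ℝ) : ℂ) (by
    intro x hx
    have h1 := hc x
    rw [hx, inner_smul_right, Complex.re_ofReal_mul] at h1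
    have h2 : (⟪(x : K), (x : K)⟫_ℂ).re = ‖(x : K)‖ ^ 2 := inner_self_eq_norm_sq (𝕜 := ℂ) (x : K)
    rw [h2] at h1
    have h3 : ‖(x : K)‖ ^ 2 ≤ 0 := by linarith
    have h4 : ‖(x : K)‖ = 0 := pow_eq_zero_iff (two_ne_zero) |>.mp (le_antisymm h3 (sq_nonneg _))
    exact norm_eq_zero.mp h4)
  have hsym : (R : K →ₗ[ℂ] K).IsSymmetric := by
    intro x y
    obtain ⟨hx, hx'⟩ := hR1 x
    obtain ⟨hy, hy'⟩ := hR1 y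
    change ⟪R x, y⟫_ℂ = ⟪x, R y⟫_ℂ
    conv_lhs => rw [← hy']
    conv_rhs => rw [← hx']
    rw [inner_sub_left, inner_sub_right, hs ⟨R x, hx⟩ ⟨R y, hy⟩, inner_smul_left, inner_smul_right,
      Complex.conj_ofReal]
  obtain ⟨ι, b, p, hp⟩ := exists_eigenbasis hcR hsym
  have hmem : ∀ i, b i ∈ eigenspace T (c - 1 + (p i)⁻¹) := by
    intro i
    obtain ⟨hm, hval⟩ := hR1 (b i)
    have hb0 : b i ≠ 0 := b.orthonormal.ne_zero i
    have hp0 : (p i : ℂ) ≠ 0 := by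
      intro h0
      have h1 : R (b i) = 0 := by rw [hp, h0, zero_smul]
      have h2 : (⟨R (b i), hm⟩ : T.domain) = 0 := Subtype.ext h1
      rw [h2, LinearPMap.map_zero, h1, smul_zero, sub_zero] at hval
      exact hb0 hval.symm
    have h3 : b i = (p i : ℂ)⁻¹ • R (b i) := by rw [hp, inv_smul_smul₀ hp0]
    have h4 : R (b i) ∈ eigenspace T (c - 1 + (p i)⁻¹) := by
      refine ⟨hm, ?_⟩
      rw [sub_eq_iff_eq_add.mp hval, Complex.ofReal_add, Complex.ofReal_inv, add_smul, ← h3,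
        add_comm]
    rw [h3]
    exact Submodule.smul_mem _ _ h4
  exact ⟨ι, b, fun i => ⟨_, mem_spec_of_mem_eigenspace (hmem i) (b.orthonormal.ne_zero i)⟩, hmem⟩

end Resolvent

/-! ### The classical entropy argument -/

section Kinetic

/-- If `log` is evaluated at positive arguments, `a log b - a log a ≤ b - a`, with equality only
for `a = b`. -/
lemma mul_log_sub_le {a b : ℝ} (ha : 0 < a) (hb : 0 < b) :
    Real.negMulLog a + a ≤ -(a * Real.log b) + b ∧
      (Real.negMulLog a + a = -(a * Real.log b) + b → a = b) := by
  have h1 : a * (Real.log (b / a) - (b / a - 1)) =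
      Real.negMulLog a + a - (-(a * Real.log b) + b) := by
    rw [Real.log_div hb.ne' ha.ne', Real.negMulLog]
    field_simp
    ring
  constructor
  · have h2 := Real.log_le_sub_one_of_pos (div_pos hb ha)
    have h3 : a * (Real.log (b / a) - (b / a - 1)) ≤ 0 :=
      mul_nonpos_of_nonneg_of_nonpos ha.le (by linarith)
    linarith
  · intro heq
    by_contra hne
    have h2 := Real.log_lt_sub_one_of_pos (div_pos hb ha)
      (fun h => hne ((div_eq_one_iff_eq ha.ne').mp h).symm)
    have h3 : a * (Real.log (b / a) - (b / a - 1)) < 0 :=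
      mul_neg_of_pos_of_neg ha (by linarith)
    linarith

lemma eq_of_tsum_eq_of_le {α : Type*} {f g : α → ℝ≥0∞} (hle : ∀ a, f a ≤ g a)
    (hsum : ∑' a, f a = ∑' a, g a) (hfin : ∑' a, f a ≠ ⊤) (a : α) : f a = g a := by
  by_contra hne
  exact (ENNReal.tsum_lt_tsum hfin hle (lt_of_le_of_ne (hle a) hne)).ne hsum

/-- The entropy argument: a doubly stochastic kernel `M` for which the image of `p ⊗ p` has both
marginals equal to `p`, where `p` has finite entropy, only connects pairs with the same value of
`p ⊗ p`. -/
lemma mul_eq_mul_of_marginals {ι : Type*} {p : ι → ℝ} (hp : ∀ i, 0 ≤ p i)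
    (hp1 : ∑' i, ENNReal.ofReal (p i) = 1)
    (hS : ∑' i, ENNReal.ofReal (Real.negMulLog (p i)) ≠ ⊤) {M : ι × ι → ι × ι → ℝ≥0∞}
    (hrow : ∀ m, ∑' k, M m k = 1) (hcol : ∀ k, ∑' m, M m k = 1)
    (hmarg₁ : ∀ i, ∑' j, ∑' k : ι × ι, ENNReal.ofReal (p k.1 * p k.2) * M (i, j) k =
      ENNReal.ofReal (p i))
    (hmarg₂ : ∀ j, ∑' i, ∑' k : ι × ι, ENNReal.ofReal (p k.1 * p k.2) * M (i, j) k =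
      ENNReal.ofReal (p j)) {m k : ι × ι} (hmk : M m k ≠ 0) :
    p m.1 * p m.2 = p k.1 * p k.2 := by
  set a : ι × ι → ℝ := fun m => p m.1 * p m.2 with ha_def
  set t : ι × ι → ℝ≥0∞ := fun m => ∑' k, ENNReal.ofReal (a k) * M m k with ht_def
  have ha : ∀ m, 0 ≤ a m := fun m => mul_nonneg (hp _) (hp _)
  have hp_le : ∀ i, p i ≤ 1 := fun i => by
    have := (ENNReal.le_tsum i).trans_eq hp1
    simpa using this
  have ha_le : ∀ m, a m ≤ 1 := fun m => mul_le_one₀ (hp_le _) (hp _) (hp_le _)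
  have hneg : ∀ i, 0 ≤ Real.negMulLog (p i) := fun i => Real.negMulLog_nonneg (hp i) (hp_le i)
  have hlog : ∀ i, 0 ≤ -Real.log (p i) := fun i =>
    neg_nonneg.mpr (Real.log_nonpos (hp i) (hp_le i))
  have hlog' : ∀ m, 0 ≤ -Real.log (a m) := fun m =>
    neg_nonneg.mpr (Real.log_nonpos (ha m) (ha_le m))
  have ht1 : ∀ m : ι × ι, t m ≤ ENNReal.ofReal (p m.1) := fun m =>
    (ENNReal.le_tsum (f := fun j => t (m.1, j)) m.2).trans_eq (hmarg₁ m.1)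
  have ht2 : ∀ m : ι × ι, t m ≤ ENNReal.ofReal (p m.2) := fun m =>
    (ENNReal.le_tsum (f := fun i => t (i, m.2)) m.1).trans_eq (hmarg₂ m.2)
  -- Since `Real.log 0 = 0`, zero entries need separate care: the marginals dominate `t`, so `t`
  -- vanishes wherever `a` does.
  have ht0 : ∀ m, a m = 0 → t m = 0 := fun m hm => by
    rcases mul_eq_zero.mp hm with h | h
    · simpa [h] using ht1 m
    · simpa [h] using ht2 m
  have hM0 : ∀ m k, a m = 0 → M m k = 0 ∨ a k = 0 := fun m k hm => by
    have h1 := ENNReal.tsum_eq_zero.mp (ht0 m hm) k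
    rcases mul_eq_zero.mp h1 with h | h
    · exact Or.inr (le_antisymm (ENNReal.ofReal_eq_zero.mp h) (ha k))
    · exact Or.inl h
  have hasum : ∑' m, ENNReal.ofReal (a m) = 1 := by
    rw [ENNReal.tsum_prod']
    simp only [ha_def, ENNReal.ofReal_mul (hp _), ENNReal.tsum_mul_left, hp1, mul_one]
  -- Adding `a k` on one side and `a m` on the other turns Gibbs' inequality into a termwise
  -- inequality between nonnegative quantities, so all sums live in `[0, ∞]` and may be rearranged
  -- freely. Both totals turn out to be `2s + 1`.
  let L : (ι × ι) × (ι × ι) → ℝ≥0∞ := fun q =>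
    M q.1 q.2 * (ENNReal.ofReal (Real.negMulLog (a q.2)) + ENNReal.ofReal (a q.2))
  let R : (ι × ι) × (ι × ι) → ℝ≥0∞ := fun q =>
    M q.1 q.2 * (ENNReal.ofReal (a q.2) * ENNReal.ofReal (-Real.log (a q.1)) +
      ENNReal.ofReal (a q.1))
  set s := ∑' i, ENNReal.ofReal (Real.negMulLog (p i)) with hs
  have hL : ∑' q, L q = s + s + 1 := by
    rw [ENNReal.tsum_prod', ENNReal.tsum_comm]
    simp only [L, ENNReal.tsum_mul_right, hcol, one_mul]
    rw [ENNReal.tsum_add, hasum]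
    congr 1
    have h1 : ∀ m : ι × ι, ENNReal.ofReal (Real.negMulLog (a m)) =
        ENNReal.ofReal (p m.2) * ENNReal.ofReal (Real.negMulLog (p m.1)) +
          ENNReal.ofReal (p m.1) * ENNReal.ofReal (Real.negMulLog (p m.2)) := fun m => by
      rw [← ENNReal.ofReal_mul (hp _), ← ENNReal.ofReal_mul (hp _),
        ← ENNReal.ofReal_add (mul_nonneg (hp _) (hneg _)) (mul_nonneg (hp _) (hneg _)),
        Real.negMulLog_mul]
    simp only [h1]
    rw [ENNReal.tsum_prod']
    simp only [ENNReal.tsum_add, ENNReal.tsum_mul_left, ENNReal.tsum_mul_right, hp1, one_mul,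
      ← hs]
  have hR : ∑' q, R q = s + s + 1 := by
    rw [ENNReal.tsum_prod']
    have h1 : ∀ m, ∑' k, R (m, k) = t m * ENNReal.ofReal (-Real.log (a m)) +
        ENNReal.ofReal (a m) := fun m => by
      simp only [R, mul_add, ENNReal.tsum_add, ENNReal.tsum_mul_right, hrow, one_mul]
      congr 1
      rw [ht_def, ← ENNReal.tsum_mul_right]
      refine tsum_congr fun k => ?_
      ring
    simp only [h1]
    rw [ENNReal.tsum_add, hasum]
    congr 1
    -- The logarithm of the product splits only for nonzero factors; otherwise the weight `t m` is
    -- zero.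
    have h2 : ∀ m : ι × ι, t m * ENNReal.ofReal (-Real.log (a m)) =
        t m * ENNReal.ofReal (-Real.log (p m.1)) + t m * ENNReal.ofReal (-Real.log (p m.2)) := by
      intro m
      rcases (ha m).eq_or_lt with h0 | h0
      · simp [ht0 m h0.symm]
      · have h3 : p m.1 ≠ 0 := left_ne_zero_of_mul h0.ne'
        have h4 : p m.2 ≠ 0 := right_ne_zero_of_mul h0.ne'
        rw [← mul_add, ← ENNReal.ofReal_add (hlog _) (hlog _), ha_def]
        simp only [Real.log_mul h3 h4]
        congr 2
        ring
    have h5 : ∀ i, ENNReal.ofReal (p i) * ENNReal.ofReal (-Real.log (p i)) =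
        ENNReal.ofReal (Real.negMulLog (p i)) := fun i => by
      rw [← ENNReal.ofReal_mul (hp i), Real.negMulLog]
      congr 1
      ring
    simp only [h2]
    rw [ENNReal.tsum_add]
    congr 1
    · rw [ENNReal.tsum_prod']
      simp only [ENNReal.tsum_mul_right]
      rw [hs]
      refine tsum_congr fun i => ?_
      rw [← h5, ← hmarg₁ i]
    · rw [ENNReal.tsum_prod', ENNReal.tsum_comm]
      simp only [ENNReal.tsum_mul_right]
      rw [hs]
      refine tsum_congr fun i => ?_
      rw [← h5, ← hmarg₂ i]
  have hcomb : ∀ k, ENNReal.ofReal (Real.negMulLog (a k)) + ENNReal.ofReal (a k) =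
      ENNReal.ofReal (Real.negMulLog (a k) + a k) := fun k =>
    (ENNReal.ofReal_add (Real.negMulLog_nonneg (ha k) (ha_le k)) (ha k)).symm
  have hcomb' : ∀ m k, ENNReal.ofReal (a k) * ENNReal.ofReal (-Real.log (a m)) +
      ENNReal.ofReal (a m) = ENNReal.ofReal (-(a k * Real.log (a m)) + a m) := fun m k => by
    rw [← ENNReal.ofReal_mul (ha k), ← ENNReal.ofReal_add (mul_nonneg (ha k) (hlog' m)) (ha m)]
    congr 2
    ring
  have hle : ∀ q, L q ≤ R q := by
    rintro ⟨m, k⟩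
    rcases (ha k).eq_or_lt with hk | hk
    · simp [L, ← hk]
    rcases (ha m).eq_or_lt with hm | hm
    · have := (hM0 m k hm.symm).resolve_right hk.ne'
      simp [L, this]
    · simp only [L, R]
      rw [hcomb k, hcomb']
      gcongr M m k * ENNReal.ofReal ?_
      exact (mul_log_sub_le hk hm).1
  -- Here finite entropy enters: equality of sums forces equality of terms only when the sums are
  -- finite.
  have heq := eq_of_tsum_eq_of_le hle (hL.trans hR.symm) (by rw [hL]; finiteness) (m, k)
  have hMtop : M m k ≠ ⊤ := ne_top_of_le_ne_top ENNReal.one_ne_top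
    ((ENNReal.le_tsum k).trans_eq (hrow m))
  simp only [L, R] at heq
  rw [ENNReal.mul_right_inj hmk hMtop] at heq
  change a m = a k
  rcases (ha m).eq_or_lt with hm | hm
  · rw [← hm, ((hM0 m k hm.symm).resolve_left hmk)]
  rcases (ha k).eq_or_lt with hk | hk
  · rw [← hk] at heq
    simp only [Real.negMulLog_zero, ENNReal.ofReal_zero, zero_mul, zero_add] at heq
    exact absurd (ENNReal.ofReal_eq_zero.mp heq.symm) (not_le.mpr hm)
  · rw [hcomb k, hcomb', ENNReal.ofReal_eq_ofReal_iff] at heq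
    · exact ((mul_log_sub_le hk hm).2 heq).symm
    · exact add_nonneg (Real.negMulLog_nonneg (ha k) (ha_le k)) (ha k)
    · have := mul_nonneg (ha k) (hlog' m)
      linarith

end Kinetic

/-! ### Density matrices in an eigenbasis -/

section Density

variable {K : Type u} [NormedAddCommGroup K] [InnerProductSpace ℂ K] [CompleteSpace K]

lemma IsDensityMatrix.exists_eigenbasis {ρ : K →L[ℂ] K} (hρ : IsDensityMatrix ρ) :
    ∃ (ι : Type u) (b : HilbertBasis ι ℂ K) (p : ι → ℝ), (∀ i, ρ (b i) = (p i : ℂ) • b i) ∧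
      (∀ i, 0 ≤ p i) ∧ ∑' i, ENNReal.ofReal (p i) = 1 := by
  obtain ⟨hpos, htr⟩ := hρ
  obtain ⟨ι, b, p, hp⟩ := QKac.exists_eigenbasis
    (isCompactOperator_of_posTrace hpos (by rw [htr]; exact ENNReal.one_ne_top)) hpos.isSymmetric
  refine ⟨ι, b, p, hp, fun i => ?_, by rw [← htr, posTrace_of_diagonal b hpos hp]⟩
  have h1 := hpos.re_inner_nonneg_right (b i)
  rw [hp, inner_smul_right, inner_self_eq_norm_sq_to_K, b.orthonormal.1] at h1
  simpa using h1

lemma entropy_eq {ι : Type*} (b : HilbertBasis ι ℂ K) {ρ : K →L[ℂ] K} {p : ι → ℝ}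
    (h : ∀ i, ρ (b i) = (p i : ℂ) • b i) (hp : ∀ i, 0 ≤ p i) (hp1 : ∀ i, p i ≤ 1) :
    entropy ρ = ∑' i, ENNReal.ofReal (Real.negMulLog (p i)) := by
  have h1 := fun i => cfc_apply_eigenvector (isSelfAdjoint_of_diagonal b h) (h i) Real.negMulLog
    Real.continuous_negMulLog
  exact posTrace_of_diagonal b
    (isPositive_of_diagonal b (fun i => Real.negMulLog_nonneg (hp i) (hp1 i)) h1) h1

end Density

/-! ### Transition probabilities, collision averages and partial traces -/

section Collisions

variable {H : Type u} [NormedAddCommGroup H] [InnerProductSpace ℂ H]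

lemma opTensor_tensorBasis {ι : Type*} (b : HilbertBasis ι ℂ H) {A : H →L[ℂ] H} {p : ι → ℝ}
    (h : ∀ i, A (b i) = (p i : ℂ) • b i) (k : ι × ι) :
    opTensor A A (tensorBasis b b k) = ((p k.1 * p k.2 : ℝ) : ℂ) • tensorBasis b b k := by
  rw [tensorBasis_apply, opTensor_tprod, h, h, tprod_smul_left, tprod_smul_right, smul_smul,
    Complex.ofReal_mul]

lemma swap_tensorBasis {ι : Type*} (b : HilbertBasis ι ℂ H) (k : ι × ι) :
    swap H (tensorBasis b b k) = tensorBasis b b k.swap := by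
  rw [tensorBasis_apply, tensorBasis_apply, swap_tprod]; rfl

lemma adjoint_swap : (swap H).adjoint = swap H := by
  refine ContinuousLinearMap.ext fun x => ext_inner_left ℂ fun y => ?_
  rw [ContinuousLinearMap.adjoint_inner_right, swap_inner]

namespace CollisionSpec

variable {h : H →ₗ.[ℂ] H} {C : Type v} [MetricSpace C] [CompactSpace C]
    [MeasurableSpace C] [BorelSpace C] (S : CollisionSpec h C)

lemma inner_star_op (σ : C) (x y : TwoParticle H) :
    ⟪x, (star (S.op σ)) y⟫_ℂ = ⟪S.op σ x, y⟫_ℂ :=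
  ContinuousLinearMap.adjoint_inner_right _ _ _

lemma star_op_inner (σ : C) (x y : TwoParticle H) :
    ⟪(star (S.op σ)) x, y⟫_ℂ = ⟪x, S.op σ y⟫_ℂ :=
  ContinuousLinearMap.adjoint_inner_left _ _ _

lemma inner_collisionOp (A : TwoParticle H →L[ℂ] TwoParticle H) (x y : TwoParticle H) :
    ⟪x, S.collisionOp A y⟫_ℂ = ∫ σ, ⟪(star (S.op σ)) x, A ((star (S.op σ)) y)⟫_ℂ ∂S.ν := by
  rw [collisionOp_apply, ← integral_inner (S.integrable_conj A y)]
  exact integral_congr_ae (Filter.Eventually.of_forall fun σ => (S.star_op_inner σ _ _).symm)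

lemma integrable_inner_conj (A : TwoParticle H →L[ℂ] TwoParticle H) (x y : TwoParticle H) :
    Integrable (fun σ => ⟪(star (S.op σ)) x, A ((star (S.op σ)) y)⟫_ℂ) S.ν := by
  simp only [star_op_inner]
  exact (S.integrable_conj A y).const_inner x

lemma isPositive_collisionOp {A : TwoParticle H →L[ℂ] TwoParticle H} (hA : A.IsPositive) :
    (S.collisionOp A).IsPositive := by
  rw [ContinuousLinearMap.isPositive_iff]
  refine ⟨fun x y => ?_, fun x => ?_⟩
  · change ⟪S.collisionOp A x, y⟫_ℂ = ⟪x, S.collisionOp A y⟫_ℂ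
    rw [← inner_conj_symm, inner_collisionOp, inner_collisionOp, ← integral_conj]
    refine integral_congr_ae (Filter.Eventually.of_forall fun σ => ?_)
    change (starRingEnd ℂ) ⟪_, _⟫_ℂ = _
    rw [inner_conj_symm, hA.inner_left_eq_inner_right]
  · rw [← inner_conj_symm, inner_collisionOp]
    have h1 : ∀ σ, ⟪(star (S.op σ)) x, A ((star (S.op σ)) x)⟫_ℂ =
        (((⟪(star (S.op σ)) x, A ((star (S.op σ)) x)⟫_ℂ).re : ℝ) : ℂ) := fun σ => inner_eq_re hA _
    rw [integral_congr_ae (Filter.Eventually.of_forall h1), integral_complex_ofReal,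
      Complex.conj_ofReal]
    exact_mod_cast integral_nonneg fun σ => hA.re_inner_nonneg_right _

lemma ofReal_inner_collisionOp {A : TwoParticle H →L[ℂ] TwoParticle H} (hA : A.IsPositive)
    (x : TwoParticle H) :
    ENNReal.ofReal (⟪x, S.collisionOp A x⟫_ℂ).re =
      ∫⁻ σ, ENNReal.ofReal (⟪(star (S.op σ)) x, A ((star (S.op σ)) x)⟫_ℂ).re ∂S.ν := by
  have h1 := S.integrable_inner_conj A x x
  have h2 := ofReal_integral_eq_lintegral_ofReal h1.re
    (Filter.Eventually.of_forall fun σ => re_inner_nonneg hA _)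
  rw [inner_collisionOp]
  refine Eq.trans ?_ h2
  congr 1
  exact (integral_re h1).symm

/-- The mean transition probability from `y` to `x`. -/
def transition (x y : TwoParticle H) : ℝ≥0∞ := ∫⁻ σ, ‖⟪x, S.op σ y⟫_ℂ‖ₑ ^ 2 ∂S.ν

lemma continuous_inner_op (x y : TwoParticle H) : Continuous fun σ => ⟪x, S.op σ y⟫_ℂ :=
  continuous_const.inner (S.continuous_U y)

lemma measurable_enorm_inner_op (x y : TwoParticle H) :
    Measurable fun σ => ‖⟪x, S.op σ y⟫_ℂ‖ₑ ^ 2 :=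
  ((S.continuous_inner_op x y).enorm.measurable).pow_const 2

/-- Parseval for the unit vector `U(σ)* c m`. Together with its companion, which uses `U(σ) c k`,
this makes the transition matrix doubly stochastic. -/
lemma tsum_transition_right {κ : Type*} [Countable κ] (c : HilbertBasis κ ℂ (TwoParticle H))
    (m : κ) : ∑' k, S.transition (c m) (c k) = 1 := by
  have := S.isProbabilityMeasure
  unfold transition
  rw [← lintegral_tsum fun k => (S.measurable_enorm_inner_op _ _).aemeasurable]
  have h1 : ∀ σ, ∑' k, ‖⟪c m, S.op σ (c k)⟫_ℂ‖ₑ ^ 2 = 1 := fun σ => by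
    simp only [← S.star_op_inner, enorm_inner_comm ((star (S.op σ)) (c m))]
    rw [tsum_enorm_inner_sq, ← ofReal_norm, S.norm_star_op_apply, c.orthonormal.1]
    simp
  simp [h1]

lemma tsum_transition_left {κ : Type*} [Countable κ] (c : HilbertBasis κ ℂ (TwoParticle H))
    (k : κ) : ∑' m, S.transition (c m) (c k) = 1 := by
  have := S.isProbabilityMeasure
  unfold transition
  rw [← lintegral_tsum fun k => (S.measurable_enorm_inner_op _ _).aemeasurable]
  have h1 : ∀ σ, ∑' m, ‖⟪c m, S.op σ (c k)⟫_ℂ‖ₑ ^ 2 = 1 := fun σ => by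
    rw [tsum_enorm_inner_sq, ← ofReal_norm, S.norm_op_apply, c.orthonormal.1]
    simp
  simp [h1]

/-- Conjugation by the swap only relabels the collision parameter by a map preserving `ν`. This
transfers the first marginal to the second. -/
lemma transition_swap (x y : TwoParticle H) :
    S.transition (swap H x) (swap H y) = S.transition x y := by
  obtain ⟨τ, hτ, hmp⟩ := S.swap_symmetric
  unfold transition
  rw [← hmp.lintegral_comp (S.measurable_enorm_inner_op x y)]
  refine lintegral_congr fun σ => ?_
  have h1 : S.op (τ σ) y = swap H (S.op σ (swap H y)) := by
    rw [CollisionSpec.op, ← hτ σ, adjoint_swap]; rfl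
  rw [h1, ← swap_inner]

/-- A vanishing integral gives zero almost everywhere; continuity in `σ` and the full support of `ν`
upgrade this to every `σ`. -/
lemma inner_op_eq_zero_of_transition {x y : TwoParticle H} (h0 : S.transition x y = 0) (σ : C) :
    ⟪x, S.op σ y⟫_ℂ = 0 := by
  have : S.ν.IsOpenPosMeasure := ⟨fun O hO hne => (S.charges_open O hO hne).ne'⟩
  unfold transition at h0
  rw [lintegral_eq_zero_iff (S.measurable_enorm_inner_op x y)] at h0
  have h1 : (fun σ => ⟪x, S.op σ y⟫_ℂ) =ᵐ[S.ν] fun _ => 0 := by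
    filter_upwards [h0] with σ hσ
    simpa using hσ
  exact congrFun (((S.continuous_inner_op x y).ae_eq_iff_eq S.ν continuous_const).mp h1) σ

/-- The diagonal entries of `Q A`, for a diagonal operator `A`. -/
lemma ofReal_inner_collisionOp_of_diagonal {κ : Type*} [Countable κ]
    (c : HilbertBasis κ ℂ (TwoParticle H)) {A : TwoParticle H →L[ℂ] TwoParticle H} {a : κ → ℝ}
    (ha : ∀ k, 0 ≤ a k) (hA : ∀ k, A (c k) = (a k : ℂ) • c k) (x : TwoParticle H) :
    ENNReal.ofReal (⟪x, S.collisionOp A x⟫_ℂ).re =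
      ∑' k, ENNReal.ofReal (a k) * S.transition x (c k) := by
  rw [S.ofReal_inner_collisionOp (isPositive_of_diagonal c ha hA)]
  simp only [ofReal_inner_of_diagonal c ha hA]
  have h1 : ∀ σ k, ‖⟪c k, (star (S.op σ)) x⟫_ℂ‖ₑ ^ 2 = ‖⟪x, S.op σ (c k)⟫_ℂ‖ₑ ^ 2 := fun σ k => by
    rw [inner_star_op, enorm_inner_comm]
  simp only [h1]
  rw [lintegral_tsum fun k => ((S.measurable_enorm_inner_op _ _).const_mul _).aemeasurable]
  refine tsum_congr fun k => ?_
  exact lintegral_const_mul _ (S.measurable_enorm_inner_op _ _)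

/-- A diagonal operator commutes with the collision unitaries if these only connect basis vectors
with the same entry. -/
lemma op_comp_of_diagonal {κ : Type*} (c : HilbertBasis κ ℂ (TwoParticle H))
    {A : TwoParticle H →L[ℂ] TwoParticle H} {a : κ → ℝ} (hA : ∀ k, A (c k) = (a k : ℂ) • c k)
    (σ : C) (h0 : ∀ m k, ⟪c m, S.op σ (c k)⟫_ℂ ≠ 0 → a m = a k) :
    S.op σ ∘L A = A ∘L S.op σ := by
  refine ext_hilbertBasis c fun k => ext_inner_hilbertBasis c fun m => ?_
  rw [ContinuousLinearMap.comp_apply, ContinuousLinearMap.comp_apply, hA,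
    inner_of_diagonal c hA, map_smul, inner_smul_right]
  by_cases hz : ⟪c m, S.op σ (c k)⟫_ℂ = 0
  · rw [hz, mul_zero, mul_zero]
  · rw [h0 m k hz]

lemma collisionOp_of_commute {A : TwoParticle H →L[ℂ] TwoParticle H}
    (hA : ∀ σ, S.op σ ∘L A = A ∘L S.op σ) : S.collisionOp A = A := by
  have := S.isProbabilityMeasure
  ext x
  rw [collisionOp_apply]
  have h1 : ∀ σ, S.op σ (A ((star (S.op σ)) x)) = A x := fun σ => by
    have := congrArg (fun T : TwoParticle H →L[ℂ] TwoParticle H => T ((star (S.op σ)) x)) (hA σ)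
    refine this.trans ?_
    change A (S.op σ ((star (S.op σ)) x)) = A x
    rw [S.op_star_op_apply]
  simp [h1]

end CollisionSpec

variable [CompleteSpace H]

lemma inner_partialTrace_term (φ ψ x : H) (T : TwoParticle H →L[ℂ] TwoParticle H) :
    ⟪φ, ((tensorRight x).adjoint ∘L T ∘L tensorRight x) ψ⟫_ℂ = ⟪tprod φ x, T (tprod ψ x)⟫_ℂ := by
  rw [ContinuousLinearMap.comp_apply, ContinuousLinearMap.comp_apply,
    ContinuousLinearMap.adjoint_inner_right, tensorRight_apply, tensorRight_apply]

/-- The diagonal entries of the partial trace of a positive operator, in any basis. -/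
lemma ofReal_inner_partialTrace₂ {T : TwoParticle H →L[ℂ] TwoParticle H} (hT : T.IsPositive)
    (h0 : partialTrace₂ T ≠ 0) {ι : Type*} (b : HilbertBasis ι ℂ H) (φ : H) :
    ENNReal.ofReal (⟪φ, partialTrace₂ T φ⟫_ℂ).re =
      ∑' j, ENNReal.ofReal (⟪tprod φ (b j), T (tprod φ (b j))⟫_ℂ).re := by
  have hsum : Summable fun k : basisSet H =>
      (tensorRight (hbasis H k : H)).adjoint ∘L T ∘L tensorRight (hbasis H k : H) := by
    -- A divergent `tsum` takes the value zero, so a nonzero partial trace certifies convergence.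
    by_contra hns
    exact h0 (tsum_eq_zero_of_not_summable hns)
  have h1 := (hsum.hasSum.mapL (ContinuousLinearMap.apply ℂ H φ)).mapL
    (Complex.reCLM ∘L (innerSL ℂ φ).restrictScalars ℝ)
  have h2 : HasSum (fun k : basisSet H =>
      (⟪tprod φ (hbasis H k), T (tprod φ (hbasis H k))⟫_ℂ).re) (⟪φ, partialTrace₂ T φ⟫_ℂ).re := by
    convert h1 using 1
    · exact funext fun k => congrArg Complex.re (inner_partialTrace_term φ φ _ T).symm
    · rfl
  rw [← h2.tsum_eq, ENNReal.ofReal_tsum_of_nonneg (fun k => re_inner_nonneg hT _)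
    h2.summable]
  -- Compressing `T` to the vectors `φ ⊗ x` gives a positive operator on `H`, whose trace may be
  -- computed in `b` instead of the fixed basis.
  have h3 : ((tensorLeft φ).adjoint ∘L T ∘L tensorLeft φ).IsPositive := hT.adjoint_conj _
  have h4 : ∀ x : H, ⟪x, ((tensorLeft φ).adjoint ∘L T ∘L tensorLeft φ) x⟫_ℂ =
      ⟪tprod φ x, T (tprod φ x)⟫_ℂ := fun x => by
    rw [ContinuousLinearMap.comp_apply, ContinuousLinearMap.comp_apply,
      ContinuousLinearMap.adjoint_inner_right, tensorLeft_apply]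
  have h5 := tsum_ofReal_inner_eq (hbasis H) b h3
  simpa only [h4] using h5

/-- Each term of the series is `⟨x, ρ x⟩ A`, and these coefficients sum to the trace of `ρ`, which
is one. -/
lemma partialTrace₂_opTensor {ρ : H →L[ℂ] H} (hρ : IsDensityMatrix ρ) (A : H →L[ℂ] H) :
    partialTrace₂ (opTensor A ρ) = A := by
  obtain ⟨hpos, htr⟩ := hρ
  have h1 : ∀ x : H, (tensorRight x).adjoint ∘L opTensor A ρ ∘L tensorRight x =
      ((⟪x, ρ x⟫_ℂ).re : ℂ) • A := fun x => by
    refine ContinuousLinearMap.ext fun ψ => ext_inner_left ℂ fun φ => ?_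
    rw [inner_partialTrace_term, opTensor_tprod, inner_tprod, smul_apply,
      inner_smul_right, ← inner_eq_re hpos, mul_comm]
  have h3 : HasSum (fun k : basisSet H => (⟪hbasis H k, ρ (hbasis H k)⟫_ℂ).re) 1 := by
    have h4 : ∑' k : basisSet H, ENNReal.ofReal (⟪hbasis H k, ρ (hbasis H k)⟫_ℂ).re ≠ ⊤ := by
      change posTrace ρ ≠ ⊤
      rw [htr]; exact ENNReal.one_ne_top
    have h5 := ENNReal.hasSum_toReal h4
    have h6 :
        (∑' k : basisSet H, (ENNReal.ofReal (⟪hbasis H k, ρ (hbasis H k)⟫_ℂ).re).toReal) = 1 := by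
      rw [← ENNReal.tsum_toReal_eq fun k => ENNReal.ofReal_ne_top]
      change (posTrace ρ).toReal = 1
      rw [htr, ENNReal.toReal_one]
    rw [h6] at h5
    convert h5 using 1
    ext k
    exact (ENNReal.toReal_ofReal (hpos.re_inner_nonneg_right _)).symm
  unfold partialTrace₂
  simp only [h1]
  have h7 := (h3.mapL Complex.ofRealCLM).smul_const A
  simpa using h7.tsum_eq

end Collisions

/-! ### Steady states and functions of the energy -/

section SteadyStates

variable {H : Type u} [NormedAddCommGroup H] [InnerProductSpace ℂ H]

lemma tprod_ne_zero {x y : H} (hx : x ≠ 0) (hy : y ≠ 0) : tprod x y ≠ 0 := by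
  intro h0
  have h1 := inner_tprod x y x y
  rw [h0, inner_zero_left] at h1
  rcases mul_eq_zero.mp h1.symm with h | h
  · exact hx (inner_self_eq_zero.mp h)
  · exact hy (inner_self_eq_zero.mp h)

/-- The extended logarithm is injective and turns products into sums even at zero, so the
conventions for `-∞` are exactly those of multiplication by zero. -/
lemma logAdditive_iff {h : H →ₗ.[ℂ] H} {lam : Spec h → ℝ≥0} :
    LogAdditive lam ↔ ∀ e₁ e₂ e₃ e₄ : Spec h, (e₁ : ℝ) + (e₂ : ℝ) = (e₃ : ℝ) + (e₄ : ℝ) →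
      lam e₁ * lam e₂ = lam e₃ * lam e₄ := by
  unfold LogAdditive
  refine forall₄_congr fun e₁ e₂ e₃ e₄ => imp_congr_right fun _ => ?_
  rw [← ENNReal.log_mul_add, ← ENNReal.log_mul_add, ENNReal.log_injective.eq_iff]
  exact_mod_cast Iff.rfl

/-- A positive operator `ρ` such that `ρ ⊗ ρ` acts on products of eigenvectors of `h` as a function
of the total energy, is itself a function of `h`. -/
lemma exists_eigenvalues_of_opTensor {h : H →ₗ.[ℂ] H} {ρ : H →L[ℂ] H} (hρ : ρ.IsPositive)
    (hev : ∀ e : Spec h, ∃ x ∈ eigenspace h e, x ≠ 0) {F : ℝ → ℂ}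
    (hF : ∀ (e e' : ℝ) (x y : H), x ∈ eigenspace h e → y ∈ eigenspace h e' →
      tprod (ρ x) (ρ y) = F (e + e') • tprod x y) :
    ∃ lam : Spec h → ℝ≥0, (∀ (e : Spec h), ∀ x ∈ eigenspace h e, ρ x = ((lam e : ℝ) : ℂ) • x) ∧
      LogAdditive lam := by
  -- Taking both eigenvectors at the same energy `e` forces the square of the eigenvalue to be `F (e
  -- + e)`.
  let lam : Spec h → ℝ≥0 := fun e => NNReal.sqrt (F (e + e)).re.toNNReal
  have h1 : ∀ (e : Spec h), ∀ x ∈ eigenspace h e, ρ x = ((lam e : ℝ) : ℂ) • x := by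
    intro e x hx
    rcases eq_or_ne x 0 with rfl | hx0
    · simp
    have hxx : ⟪x, x⟫_ℂ ≠ 0 := fun h0 => hx0 (inner_self_eq_zero.mp h0)
    have hxx' : ⟪x, x⟫_ℂ = ((‖x‖ ^ 2 : ℝ) : ℂ) := by
      rw [inner_self_eq_norm_sq_to_K]; push_cast; rfl
    -- The Rayleigh quotient: the only candidate eigenvalue, chosen so that `ρ x - r x` is
    -- orthogonal to `x`.
    set r : ℝ := (⟪x, ρ x⟫_ℂ).re / ‖x‖ ^ 2 with hr
    have hr0 : 0 ≤ r := div_nonneg (re_inner_nonneg hρ x) (sq_nonneg _)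
    have hrx : ⟪x, ρ x⟫_ℂ = (r : ℂ) * ⟪x, x⟫_ℂ := by
      rw [hxx', ← Complex.ofReal_mul, hr, div_mul_cancel₀ _ (by positivity)]
      exact inner_eq_re hρ x
    have hort : ⟪ρ x - (r : ℂ) • x, x⟫_ℂ = 0 := by
      rw [← inner_conj_symm, inner_sub_right, inner_smul_right, hrx, sub_self, map_zero]
    have hxy := hF e e x x hx hx
    have hρx : ρ x = (r : ℂ) • x := by
      rw [← sub_eq_zero, ← inner_self_eq_zero (𝕜 := ℂ)]
      set y := ρ x - (r : ℂ) • x with hy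
      have h2 : ⟪y, y⟫_ℂ = ⟪y, ρ x⟫_ℂ := by
        conv_lhs => rw [hy]
        rw [inner_sub_right, inner_smul_right, ← hy, hort, mul_zero, sub_zero]
      -- Pairing `ρ x ⊗ ρ x = F x ⊗ x` with `y ⊗ y` gives `⟨y, ρ x⟩² = F ⟨y, x⟩² = 0`.
      have h3 := congrArg (fun z => ⟪tprod y y, z⟫_ℂ) hxy
      simp only [inner_tprod, inner_smul_right, hort, mul_zero] at h3
      rw [h2]
      exact mul_self_eq_zero.mp h3
    have hFr : F (e + e) = ((r * r : ℝ) : ℂ) := by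
      rw [hρx, tprod_smul_left, tprod_smul_right, smul_smul] at hxy
      rw [Complex.ofReal_mul]
      exact (smul_left_injective ℂ (tprod_ne_zero hx0 hx0) hxy).symm
    have hlam : (lam e : ℝ) = r := by
      simp only [lam, hFr, Complex.ofReal_re]
      rw [Real.coe_sqrt, Real.coe_toNNReal _ (mul_self_nonneg r), Real.sqrt_mul_self hr0]
    rw [hlam, hρx]
  refine ⟨lam, h1, ?_⟩
  have h2 : ∀ e e' : Spec h, (((lam e * lam e' : ℝ≥0) : ℝ) : ℂ) = F (e + e') := by
    intro e e'
    obtain ⟨x, hx, hx0⟩ := hev e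
    obtain ⟨y, hy, hy0⟩ := hev e'
    have h3 := hF e e' x y hx hy
    rw [h1 e x hx, h1 e' y hy, tprod_smul_left, tprod_smul_right, smul_smul] at h3
    rw [NNReal.coe_mul, Complex.ofReal_mul]
    exact smul_left_injective ℂ (tprod_ne_zero hx0 hy0) h3
  rw [logAdditive_iff]
  intro e₁ e₂ e₃ e₄ he
  have h3 := h2 e₁ e₂
  rw [he, ← h2 e₃ e₄] at h3
  exact_mod_cast h3

variable [CompleteSpace H]

/-- The spectral resolution of a density matrix which acts as a scalar on each eigenspace. -/
lemma hasSum_specProj_of_eigenvalues {h : H →ₗ.[ℂ] H} (hs : h.IsFormalAdjoint h) {ι : Type*}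
    (b : HilbertBasis ι ℂ H) (ε : ι → Spec h) (hb : ∀ i, b i ∈ eigenspace h (ε i))
    (hev : ∀ e : Spec h, ∃ x ∈ eigenspace h e, x ≠ 0) {ρ : H →L[ℂ] H} (hρ : IsDensityMatrix ρ)
    {lam : Spec h → ℝ≥0}
    (hlam : ∀ (e : Spec h), ∀ x ∈ eigenspace h e, ρ x = ((lam e : ℝ) : ℂ) • x) :
    HasSum (fun e : Spec h => ((lam e : ℝ) : ℂ) • specProj h e) ρ ∧
      ∑' e : Spec h, posTrace (specProj h e) * (lam e : ℝ≥0∞) = 1 := by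
  classical
  have hP : ∀ (e : Spec h) i, specProj h e (b i) = (((if ε i = e then 1 else 0 : ℝ)) : ℂ) • b i := by
    intro e i
    split_ifs with hi
    · rw [Complex.ofReal_one, one_smul]
      exact specProj_apply_of_mem (hi ▸ hb i)
    · rw [Complex.ofReal_zero, zero_smul]
      exact specProj_apply_of_ne hs (fun he => hi (Subtype.ext he.symm)) (hb i)
  have hTr : ∀ e : Spec h, posTrace (specProj h e) = ∑' i, if ε i = e then 1 else 0 := fun e => by
    rw [posTrace_of_diagonal b (isPositive_specProj h e) (hP e)]
    refine tsum_congr fun i => ?_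
    split_ifs <;> simp
  have htrace : ∑' e : Spec h, posTrace (specProj h e) * (lam e : ℝ≥0∞) = 1 := by
    rw [← hρ.2, posTrace_of_diagonal b hρ.1 fun i => hlam (ε i) (b i) (hb i)]
    simp only [hTr, ← ENNReal.tsum_mul_right]
    rw [ENNReal.tsum_comm]
    refine tsum_congr fun i => ?_
    simp [ite_mul]
  refine ⟨?_, htrace⟩
  -- Every spectral value is an eigenvalue, so multiplicities are at least one and `∑ λ_e ≤ 1`. This
  -- gives norm convergence of the spectral series.
  have hone : ∀ e : Spec h, 1 ≤ posTrace (specProj h e) := fun e => by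
    obtain ⟨x, hx, hx0⟩ := hev e
    have : ∃ i, ε i = e := by
      by_contra! hcon
      refine hx0 (ext_inner_hilbertBasis b fun i => ?_)
      rw [inner_zero_right]
      exact inner_eq_zero_of_mem_eigenspace hs (fun he => hcon i (Subtype.ext he)) (hb i) hx
    obtain ⟨i, hi⟩ := this
    rw [hTr]
    refine le_trans ?_ (ENNReal.le_tsum i)
    rw [if_pos hi]
  have hsum : Summable fun e : Spec h => ((lam e : ℝ) : ℂ) • specProj h e := by
    have h1 : ∑' e : Spec h, (lam e : ℝ≥0∞) ≠ ⊤ := by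
      refine ne_top_of_le_ne_top ENNReal.one_ne_top (htrace ▸ ENNReal.tsum_le_tsum fun e => ?_)
      exact le_mul_of_one_le_left zero_le (hone e)
    have h2 : Summable fun e : Spec h => (lam e : ℝ) :=
      NNReal.summable_coe.mpr (ENNReal.tsum_coe_ne_top_iff_summable.mp h1)
    refine Summable.of_norm_bounded h2 fun e => ?_
    rw [norm_smul]
    have h3 : ‖((lam e : ℝ) : ℂ)‖ = lam e := by simp
    rw [h3]
    exact mul_le_of_le_one_right (NNReal.coe_nonneg _) (norm_specProj_le h e)
  have heq : ∑' e : Spec h, ((lam e : ℝ) : ℂ) • specProj h e = ρ := by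
    refine ext_hilbertBasis b fun i => ?_
    rw [hlam (ε i) (b i) (hb i)]
    exact hasSum_specProj_apply hs (ε i) (hb i)
      (hsum.hasSum.mapL (ContinuousLinearMap.apply ℂ H (b i)))
  rw [← heq]
  exact hsum.hasSum

namespace CollisionSpec

variable {h : H →ₗ.[ℂ] H} {C : Type v} [MetricSpace C] [CompactSpace C]
    [MeasurableSpace C] [BorelSpace C]

/-- For a steady state `ρ` of finite entropy, `ρ ⊗ ρ` commutes with all collisions. -/
lemma IsSteadyState.op_comp_opTensor [TopologicalSpace.SeparableSpace H] {S : CollisionSpec h C}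
    {ρ : H →L[ℂ] H} (hρ : S.IsSteadyState ρ) (hent : entropy ρ < ⊤) (σ : C) :
    S.op σ ∘L opTensor ρ ρ = opTensor ρ ρ ∘L S.op σ := by
  obtain ⟨hd, hst⟩ := hρ
  obtain ⟨ι, b, p, hb, hp, hp1⟩ := hd.exists_eigenbasis
  have := hilbertBasis_countable b
  have hp_le : ∀ i, p i ≤ 1 := fun i => by
    have := (ENNReal.le_tsum i).trans_eq hp1
    simpa using this
  have hA := opTensor_tensorBasis b hb
  have ha : ∀ k : ι × ι, 0 ≤ p k.1 * p k.2 := fun k => mul_nonneg (hp _) (hp _)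
  rw [entropy_eq b hb hp hp_le] at hent
  have hpos := isPositive_of_diagonal (tensorBasis b b) ha hA
  -- Needed to exclude the default value zero of a divergent partial trace.
  have hρ0 : ρ ≠ 0 := by
    rintro rfl
    have h1 : ∀ i, p i = 0 := fun i => by
      simpa [b.orthonormal.ne_zero i] using (hb i).symm
    simp [h1] at hp1
  have hmarg : ∀ i, ∑' j, ∑' k : ι × ι, ENNReal.ofReal (p k.1 * p k.2) *
      S.transition (tensorBasis b b (i, j)) (tensorBasis b b k) = ENNReal.ofReal (p i) := by
    intro i
    have h1 : partialTrace₂ (S.collisionOp (opTensor ρ ρ)) = ρ := hst.symm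
    have h2 := ofReal_inner_partialTrace₂ (S.isPositive_collisionOp hpos) (by rwa [h1]) b (b i)
    rw [h1, hb, inner_smul_right, inner_self_eq_norm_sq_to_K, b.orthonormal.1] at h2
    have h3 : ENNReal.ofReal ((p i : ℂ) * ((1 : ℝ) : ℂ) ^ 2).re = ENNReal.ofReal (p i) := by simp
    refine Eq.trans ?_ (h2.symm.trans h3)
    refine tsum_congr fun j => ?_
    rw [← S.ofReal_inner_collisionOp_of_diagonal (tensorBasis b b) ha hA, tensorBasis_apply]
  refine S.op_comp_of_diagonal (tensorBasis b b) hA σ fun m k hmk => ?_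
  refine mul_eq_mul_of_marginals hp hp1 hent.ne
    (M := fun m k => S.transition (tensorBasis b b m) (tensorBasis b b k))
    (S.tsum_transition_right (tensorBasis b b)) (S.tsum_transition_left (tensorBasis b b)) hmarg
    (fun j => ?_) (fun h0 => hmk (S.inner_op_eq_zero_of_transition h0 σ))
  -- The second marginal: exchange the two particles in both indices of the transition matrix, under
  -- which it and `p k.1 * p k.2` are invariant.
  rw [← hmarg j]
  refine tsum_congr fun i => ?_
  rw [← (Equiv.prodComm ι ι).tsum_eq]
  refine tsum_congr fun k => ?_
  rw [← S.transition_swap, swap_tensorBasis, swap_tensorBasis]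
  simp [mul_comm]

end CollisionSpec

end SteadyStates

end QKac

end

/-! ### Characterisation of the steady states -/

theorem theorem3p8 {H : Type*} [NormedAddCommGroup H] [InnerProductSpace ℂ H] [CompleteSpace H]
    [TopologicalSpace.SeparableSpace H]
    (h : H →ₗ.[ℂ] H) (hsa : IsSelfAdjoint h) (hbelow : QKac.IsBoundedBelow h)
    (hcompact : QKac.HasCompactResolvent h)
    {C : Type*} [MetricSpace C] [CompactSpace C] [MeasurableSpace C] [BorelSpace C]
    (S : QKac.CollisionSpec h C) (hS : S.IsErgodic) :
    (∀ ρ : H →L[ℂ] H, S.IsSteadyState ρ → QKac.entropy ρ < ⊤ →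
      ∃ lam : QKac.Spec h → NNReal,
        HasSum (fun e : QKac.Spec h => ((lam e : ℝ) : ℂ) • QKac.specProj h e) ρ ∧
        ∑' e : QKac.Spec h, QKac.posTrace (QKac.specProj h e) * (lam e : ENNReal) = 1 ∧
        QKac.LogAdditive lam) ∧
    (∀ ρ : H →L[ℂ] H, QKac.IsDensityMatrix ρ →
      ∀ lam : QKac.Spec h → NNReal,
        HasSum (fun e : QKac.Spec h => ((lam e : ℝ) : ℂ) • QKac.specProj h e) ρ →
        QKac.LogAdditive lam → S.IsSteadyState ρ) := by
  classical
  have hs : h.IsFormalAdjoint h := by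
    have h1 := LinearPMap.adjoint_isFormalAdjoint (T := h) hsa.dense_domain
    rwa [LinearPMap.isSelfAdjoint_def.mp hsa] at h1
  have hs₂ := QKac.hamiltonian₂_isFormalAdjoint hs
  obtain ⟨ι, b, ε, hb⟩ := QKac.exists_eigenbasis_of_hasCompactResolvent hs hbelow hcompact
  have hev : ∀ e : QKac.Spec h, ∃ x ∈ QKac.eigenspace h e, x ≠ 0 := fun e =>
    QKac.exists_mem_eigenspace_of_mem_spec hcompact e.2
  refine ⟨fun ρ hρ hent => ?_, fun ρ hρ lam hsum hlog => ⟨hρ, ?_⟩⟩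
  · have hmem : QKac.opTensor ρ ρ ∈ QKac.energyAlgebra (QKac.hamiltonian₂ h) := by
      rw [← hS]
      exact fun σ => hρ.op_comp_opTensor hent σ
    obtain ⟨f, hf⟩ := hmem
    -- The extension by zero is harmless: `e + e'` lies in the spectrum of `H₂` whenever both
    -- eigenvectors are nonzero.
    let F : ℝ → ℂ := fun E =>
      if hE : E ∈ QKac.Spec (QKac.hamiltonian₂ h) then f ⟨E, hE⟩ else 0
    obtain ⟨lam, hlam, hlog⟩ := QKac.exists_eigenvalues_of_opTensor (F := F) hρ.1.1 hev (by
      intro e e' x y hx hy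
      rcases eq_or_ne x 0 with rfl | hx0
      · rw [map_zero, ← QKac.tensorRight_apply, ← QKac.tensorRight_apply, map_zero, map_zero,
          smul_zero]
      rcases eq_or_ne y 0 with rfl | hy0
      · rw [map_zero, ← QKac.tensorLeft_apply, ← QKac.tensorLeft_apply, map_zero, map_zero,
          smul_zero]
      have hxy := QKac.tprod_mem_eigenspace hx hy
      have hE := QKac.mem_spec_of_mem_eigenspace hxy (QKac.tprod_ne_zero hx0 hy0)
      have h1 := QKac.hasSum_specProj_apply hs₂ ⟨e + e', hE⟩ hxy (hf (QKac.tprod x y))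
      rw [QKac.opTensor_tprod] at h1
      simp only [F, dif_pos hE, h1])
    obtain ⟨h1, h2⟩ := QKac.hasSum_specProj_of_eigenvalues hs b ε hb hev hρ.1 hlam
    exact ⟨lam, h1, h2, hlog⟩
  · have hρb : ∀ i, ρ (b i) = ((lam (ε i) : ℝ) : ℂ) • b i := fun i =>
      QKac.hasSum_specProj_apply hs (ε i) (hb i)
        (hsum.mapL (ContinuousLinearMap.apply ℂ H (b i)))
    have hA := QKac.opTensor_tensorBasis b hρb
    have hE : ∀ k : ι × ι, QKac.tensorBasis b b k ∈
        QKac.eigenspace (QKac.hamiltonian₂ h) ((ε k.1 : ℝ) + ε k.2) := fun k => by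
      rw [QKac.tensorBasis_apply]
      exact QKac.tprod_mem_eigenspace (hb k.1) (hb k.2)
    have hcomm : ∀ σ, S.op σ ∘L QKac.opTensor ρ ρ = QKac.opTensor ρ ρ ∘L S.op σ := fun σ => by
      refine S.op_comp_of_diagonal (QKac.tensorBasis b b) hA σ fun m k hmk => ?_
      have h1 : S.op σ (QKac.tensorBasis b b k) ∈
          QKac.eigenspace (QKac.hamiltonian₂ h) ((ε k.1 : ℝ) + ε k.2) := by
        obtain ⟨hm, hval⟩ := hE k
        obtain ⟨hm', hval'⟩ := S.commutes σ ⟨_, hm⟩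
        exact ⟨hm', by rw [hval', hval, map_smul]⟩
      -- A collision keeps a vector in its energy eigenspace, and distinct eigenspaces of `H₂` are
      -- orthogonal; a nonzero matrix element therefore conserves energy.
      have h2 : (ε m.1 : ℝ) + ε m.2 = ε k.1 + ε k.2 := by
        by_contra hne
        exact hmk (QKac.inner_eq_zero_of_mem_eigenspace hs₂ hne (hE m) h1)
      exact_mod_cast QKac.logAdditive_iff.mp hlog _ _ _ _ h2
    rw [QKac.CollisionSpec.wild, S.collisionOp_of_commute hcomm, QKac.partialTrace₂_opTensor hρ]
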